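/- Let $\omega=\{0,1,2,\dots\}$. A \emph{computable copy} of $(\omega,<)$ is a structure $\mathcal A=(\omega,\prec)$ such that $\prec$ is a computable ordering of $\omega$ and $(\omega,\prec)\cong(\omega,<)$. For $f\colon\omega\to\omega$ and the isomorphism $\varphi\colon(\omega,<)\to\mathcal A$, let $f_{\mathcal A}$ be the image under $\varphi$ of the graph of $f$, i.e. $f_{\mathcal A}=\{(\varphi(x),\varphi(f(x))) : x\in\omega\}$. The \emph{degree spectrum} $DgSp(f)$ is the set of Turing degrees of $f_{\mathcal A}$ over all computable copies $\mathcal A$ of $(\omega,<)$. A total function $f\colon\omega\to\omega$ is a \emph{block function} if every $a\in\omega$ belongs to a finite interval $I$ of $(\omega,<)$ that is closed under $f$ and under $f^{-1}$ (that is, $x\in I\iff f(x)\in I$ for every $x\in\omega$). If $I$ is the least such interval with respect to inclusion, the structure $(I,<,f\upharpoonright I)$ is called the \emph{$f$-block} of $a$; the isomorphism types of $f$-blocks are the \emph{$f$-types}. The function $f$ is \emph{almost identity} if $f(x)=x$ for all but finitely many $x$. A \emph{$\Delta_2$ degree} is the Turing degree of a $\Delta_2$ (i.e. both $\Sigma_2$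 and $\Pi_2$) subset of $\omega$. \textbf{Theorem.} Let $f\colon\omega\to\omega$ be a computable block function that has only finitely many $f$-types and is not almost identity. Then $DgSp(f)$ is exactly the set of all $\Delta_2$ degrees. -/

import Mathlib

namespace DegreeSpectra

/-! ### Turing degrees of sets and relations, and the `Δ₂` degrees -/

open Classical in
/-- The characteristic function of a set of natural numbers. -/
noncomputable def charFun (X : Set ℕ) : ℕ → ℕ := fun n => if n ∈ X then 1 else 0

/-- The Turing degree of a set of natural numbers. -/
noncomputable def setDegree (X : Set ℕ) : TuringDegree :=
  toAntisymmetrization TuringReducible (charFun X : ℕ →. ℕ)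

/-- The Turing degree of a binary relation on `ℕ`: the degree of its set of coded pairs. -/
noncomputable def relDegree (R : ℕ → ℕ → Prop) : TuringDegree :=
  setDegree {n : ℕ | R n.unpair.1 n.unpair.2}

/-- `X` is `Σ₂`: it is of the form `{n | ∃ a, ∀ b, R n a b}` with `R` computable. -/
def IsSigma2 (X : Set ℕ) : Prop :=
  ∃ R : ℕ → ℕ → ℕ → Prop, ComputablePred (fun p : ℕ × ℕ × ℕ => R p.1 p.2.1 p.2.2) ∧
    ∀ n, n ∈ X ↔ ∃ a, ∀ b, R n a b

/-- `X` is `Π₂`: it is of the form `{n | ∀ a, ∃ b, R n a b}` with `R` computable. -/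
def IsPi2 (X : Set ℕ) : Prop :=
  ∃ R : ℕ → ℕ → ℕ → Prop, ComputablePred (fun p : ℕ × ℕ × ℕ => R p.1 p.2.1 p.2.2) ∧
    ∀ n, n ∈ X ↔ ∀ a, ∃ b, R n a b

/-- `X` is `Δ₂`. -/
def IsDelta2 (X : Set ℕ) : Prop := IsSigma2 X ∧ IsPi2 X

/-- The `Δ₂` degrees: the Turing degrees of `Δ₂` sets. -/
def delta2Degrees : Set TuringDegree := {d | ∃ X : Set ℕ, IsDelta2 X ∧ setDegree X = d}

/-! ### Computable copies of `(ω, <)` and degree spectra -/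

/-- `(ω, r)` is a computable copy of `(ω, <)`: `r` is computable and there is an isomorphism
from `(ω, <)` to `(ω, r)` (so `r` is in particular a strict linear order). -/
def IsComputableCopy (r : ℕ → ℕ → Prop) : Prop :=
  ComputablePred (fun p : ℕ × ℕ => r p.1 p.2) ∧
    Nonempty (((· < ·) : ℕ → ℕ → Prop) ≃r r)

/-- The degree spectrum of a binary relation `R` on `(ω, <)`: the set of Turing degrees of the
images of `R` under the isomorphisms from `(ω, <)` to its computable copies. -/
def DgSpRel (R : ℕ → ℕ → Prop) : Set TuringDegree :=
  {d | ∃ r : ℕ → ℕ → Prop, IsComputableCopy r ∧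
    ∃ φ : ((· < ·) : ℕ → ℕ → Prop) ≃r r, relDegree (Relation.Map R φ φ) = d}

/-- The degree spectrum of a unary function, that is, of its graph. -/
def DgSp (f : ℕ → ℕ) : Set TuringDegree := DgSpRel (fun x y => f x = y)

/-! ### Block functions -/

/-- `I` is a finite interval of `(ω, <)` closed under `f` and under `f⁻¹`. -/
def IsClosedInterval (f : ℕ → ℕ) (I : Set ℕ) : Prop :=
  I.Finite ∧ I.OrdConnected ∧ (∀ x ∈ I, f x ∈ I) ∧ (∀ x, f x ∈ I → x ∈ I)

/-- `f` is a block function: every number lies in a finite interval closed under `f`, `f⁻¹`. -/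
def IsBlockFunction (f : ℕ → ℕ) : Prop := ∀ a, ∃ I : Set ℕ, a ∈ I ∧ IsClosedInterval f I

/-- `I` is the domain of the `f`-block of `a`: the least finite interval that contains `a`
and is closed under `f` and `f⁻¹`. -/
def IsBlockOf (f : ℕ → ℕ) (a : ℕ) (I : Set ℕ) : Prop :=
  IsLeast {J : Set ℕ | a ∈ J ∧ IsClosedInterval f J} I

/-- The `f`-blocks, each given by its domain `I` and regarded as the structure `(I, <, f ↾ I)`. -/
def FBlock (f : ℕ → ℕ) : Type := {I : Set ℕ // ∃ a, IsBlockOf f a I}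

/-- Isomorphism of `f`-blocks as structures `(I, <, f ↾ I)`. -/
def BlockIso (f : ℕ → ℕ) (I J : FBlock f) : Prop :=
  ∃ e : I.1 ≃o J.1, ∀ x y : I.1, f x = y ↔ f (e x) = e y

theorem blockIso_equivalence (f : ℕ → ℕ) : Equivalence (BlockIso f) where
  refl _ := ⟨OrderIso.refl _, fun _ _ => Iff.rfl⟩
  symm := by
    rintro I J ⟨e, he⟩
    refine ⟨e.symm, fun x y => ?_⟩
    simpa using (he (e.symm x) (e.symm y)).symm
  trans := by
    rintro I J K ⟨e, he⟩ ⟨g, hg⟩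
    exact ⟨e.trans g, fun x y => (he x y).trans (hg (e x) (e y))⟩

/-- The `f`-types: isomorphism types of `f`-blocks. -/
def FType (f : ℕ → ℕ) : Type := Quotient (Setoid.mk (BlockIso f) (blockIso_equivalence f))

/-- `f` is almost identity: `f x = x` for all but finitely many `x`. -/
def IsAlmostIdentity (f : ℕ → ℕ) : Prop := {x | f x ≠ x}.Finite

end DegreeSpectra

namespace DegreeSpectra

/-! ### Closure properties of computable functions and predicates -/

section Toolbox

variable {α β γ σ : Type*} [Primcodable α] [Primcodable β] [Primcodable γ] [Primcodable σ]

/-! One inclusion is general. In a computable copy, the position of an element is the limit of the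
number of smaller elements seen so far, so the image of a computable `f` is limit computable, hence
`Δ₂` (`dgSp_subset_delta2Degrees`).

For the other inclusion, finitely many block types give cuts of `f` with bounded gaps
(`exists_cut_bound`). A word is the pattern of `f` between two cuts. Far enough out, every short
word that occurs recurs infinitely often. By `isRec_dichotomy`, either two different recurring words
have the same length, or some nontrivial word has all its powers recurring. Each case gives a
`CodingGadget`: a growing finite set of elements that can be laid out again and again, its induced
map switching between two fixed maps with each mind change. With two words one alternates between
them. With powers one passes to a longer power and shifts the elements by one relative to the
period.

Given a `Δ₂` set with a mind change counter (`IsDelta2.exists_counter`), a copy is built in stages.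
Region `n + 1` holds a gadget for bit `n`, and region `0` holds an initial segment of `f`. When some
bit changes, the items of the unaffected lower regions stay, while all later items move right to new
occurrences of their words and the gaps are filled with fresh items (`StageInv.exists_step`). The
order of elements already present never changes, so the order of the copy is computable. Each region
moves finitely often, so the limit has order type `ω`.

In the limit the image of an element under `f` is computed from one bit of the set, the bit of its
region (`exists_listing`). Conversely, the image of the distinguished element of a gadget reveals
its bit. So the image of the graph has the degree of the set (`delta2Degrees_subset_dgSp`). -/

theorem computable_list_foldl {f : α → List β} {g : α → σ} {h : α → σ × β → σ}
    (hf : Computable f) (hg : Computable g) (hh : Computable₂ h) :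
    Computable fun a => (f a).foldl (fun s b => h a (s, b)) (g a) := by
  have key : Computable fun a => Nat.rec (motive := fun _ => σ) (g a)
      (fun y s => Option.casesOn ((f a)[y]?) s (fun b => h a (s, b))) (f a).length := by
    refine Computable.nat_rec (h := fun a p => Option.casesOn ((f a)[p.1]?) p.2
      (fun b => h a (p.2, b))) (Computable.list_length.comp hf) hg ?_
    refine Computable.option_casesOn (o := fun q : α × ℕ × σ => (f q.1)[q.2.1]?)
      (g := fun q b => h q.1 (q.2.2, b)) ?_ ?_ ?_
    · exact Computable.list_getElem?.comp (hf.comp Computable.fst)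
        (Computable.fst.comp Computable.snd)
    · exact Computable.snd.comp Computable.snd
    · exact hh.comp (Computable.fst.comp Computable.fst)
        ((Computable.snd.comp (Computable.snd.comp Computable.fst)).pair Computable.snd)
  refine key.of_eq fun a => ?_
  have : ∀ n ≤ (f a).length, Nat.rec (motive := fun _ => σ) (g a)
      (fun y s => Option.casesOn ((f a)[y]?) s (fun b => h a (s, b))) n
      = ((f a).take n).foldl (fun s b => h a (s, b)) (g a) := by
    intro n hn
    induction n with
    | zero => simp
    | succ n ih =>
      have hlt : n < (f a).length := hn
      rw [List.take_add_one, List.foldl_append, ← ih hlt.le]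
      simp [List.getElem?_eq_getElem hlt]
  simpa using this _ le_rfl

theorem computable_list_flatMap {f : α → List β} {g : α → β → List σ}
    (hf : Computable f) (hg : Computable₂ g) : Computable fun a => (f a).flatMap (g a) := by
  have := computable_list_foldl (h := fun a (p : List σ × β) => p.1 ++ g a p.2) hf
    (Computable.const []) (Computable.list_append.comp (Computable.fst.comp Computable.snd)
      (hg.comp Computable.fst (Computable.snd.comp Computable.snd)))
  refine this.of_eq fun a => ?_
  rw [List.flatMap_eq_foldl]

theorem computable_list_map {f : α → List β} {g : α → β → σ}
    (hf : Computable f) (hg : Computable₂ g) : Computable fun a => (f a).map (g a) := by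
  have := computable_list_flatMap (g := fun a b => [g a b]) hf
    (Computable.list_cons.comp hg (Computable.const []))
  refine this.of_eq fun a => ?_
  rw [List.map_eq_flatMap]

theorem ComputablePred.and {p q : α → Prop} (hp : ComputablePred p) (hq : ComputablePred q) :
    ComputablePred fun a => p a ∧ q a := by
  classical
  refine Computable.computablePred ((Primrec.and.to_comp.comp hp.decide hq.decide).of_eq ?_)
  intro a; simp

theorem ComputablePred.or {p q : α → Prop} (hp : ComputablePred p) (hq : ComputablePred q) :
    ComputablePred fun a => p a ∨ q a := by
  classical
  refine Computable.computablePred ((Primrec.or.to_comp.comp hp.decide hq.decide).of_eq ?_)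
  intro a; simp

theorem ComputablePred.imp {p q : α → Prop} (hp : ComputablePred p) (hq : ComputablePred q) :
    ComputablePred fun a => p a → q a :=
  (ComputablePred.or hp.not hq).of_eq fun a => by tauto

theorem ComputablePred.iff {p q : α → Prop} (hp : ComputablePred p) (hq : ComputablePred q) :
    ComputablePred fun a => (p a ↔ q a) :=
  (ComputablePred.and (ComputablePred.imp hp hq) (ComputablePred.imp hq hp)).of_eq
    fun a => by tauto

theorem ComputablePred.comp {p : β → Prop} {f : α → β} (hp : ComputablePred p)
    (hf : Computable f) : ComputablePred fun a => p (f a) := by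
  classical
  exact Computable.computablePred ((hp.decide).comp hf)

theorem ComputablePred.forall_mem {l : α → List β} {p : α → β → Prop} (hl : Computable l)
    (hp : ComputablePred fun x : α × β => p x.1 x.2) :
    ComputablePred fun a => ∀ b ∈ l a, p a b := by
  classical
  have := computable_list_foldl (g := fun _ : α => true)
    (h := fun a (x : Bool × β) => x.1 && decide (p a x.2)) hl
    (Computable.const true) (Primrec.and.to_comp.comp (Computable.fst.comp Computable.snd)
      (hp.decide.comp (Computable.fst.pair (Computable.snd.comp Computable.snd))))
  refine Computable.computablePred (this.of_eq fun a => ?_)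
  have : ∀ (l : List β) (b : Bool), l.foldl (fun s x => s && decide (p a x)) b
      = (b && decide (∀ x ∈ l, p a x)) := by
    intro l
    induction l with
    | nil => simp
    | cons x l ih => intro b; simp [ih, Bool.and_assoc]
  simpa using this (l a) true

theorem ComputablePred.forall_lt {n : α → ℕ} {p : α → ℕ → Prop} (hn : Computable n)
    (hp : ComputablePred fun x : α × ℕ => p x.1 x.2) :
    ComputablePred fun a => ∀ i < n a, p a i :=
  (ComputablePred.forall_mem (Primrec.list_range.to_comp.comp hn) hp).of_eq
    fun a => by simp

theorem ComputablePred.eq {f g : α → β} (hf : Computable f) (hg : Computable g) :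
    ComputablePred fun a => f a = g a :=
  ComputablePred.comp (p := fun x : β × β => x.1 = x.2)
    (PrimrecPred.computablePred Primrec.eq) (hf.pair hg)

theorem ComputablePred.lt {f g : α → ℕ} (hf : Computable f) (hg : Computable g) :
    ComputablePred fun a => f a < g a :=
  ComputablePred.comp (p := fun x : ℕ × ℕ => x.1 < x.2)
    (PrimrecPred.computablePred Primrec.nat_lt) (hf.pair hg)

theorem ComputablePred.le {f g : α → ℕ} (hf : Computable f) (hg : Computable g) :
    ComputablePred fun a => f a ≤ g a :=
  ComputablePred.comp (p := fun x : ℕ × ℕ => x.1 ≤ x.2)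
    (PrimrecPred.computablePred Primrec.nat_le) (hf.pair hg)

theorem ComputablePred.mem {f : α → β} {l : α → List β} (hf : Computable f)
    (hl : Computable l) : ComputablePred fun a => f a ∈ l a :=
  (ComputablePred.forall_mem (p := fun a b => ¬ f a = b) hl
    (ComputablePred.eq (hf.comp Computable.fst) Computable.snd).not).not.of_eq
    fun a => by simp

theorem computable_ite {p : α → Prop} [DecidablePred p] {f g : α → σ} (hp : ComputablePred p)
    (hf : Computable f) (hg : Computable g) : Computable fun a => if p a then f a else g a :=
  (Computable.cond hp.decide hf hg).of_eq fun a => by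
    by_cases h : p a <;> simp [h]

theorem computable_list_filter {l : α → List β} {p : α → β → Prop}
    [∀ a, DecidablePred (p a)] (hl : Computable l)
    (hp : ComputablePred fun x : α × β => p x.1 x.2) :
    Computable fun a => (l a).filter (p a ·) := by
  have : Computable₂ fun a b => if p a b then [b] else [] :=
    computable_ite (p := fun x : α × β => p x.1 x.2) hp
      (Computable.list_cons.comp Computable.snd (Computable.const [])) (Computable.const [])
  refine (computable_list_flatMap hl this).of_eq fun a => ?_
  induction l a with
  | nil => rfl
  | cons b l ih => by_cases h : p a b <;> simp [h, ih]

/-- A sequence each term of which is found by searching for a successor of the previous term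
that satisfies a computable relation. -/
theorem exists_computable_seq {R : ℕ → α → α → Prop}
    (hR : ComputablePred fun p : ℕ × α × α => R p.1 p.2.1 p.2.2) {Inv : ℕ → α → Prop} {a₀ : α}
    (h0 : Inv 0 a₀) (step : ∀ s a, Inv s a → ∃ a', R s a a')
    (pres : ∀ s a a', Inv s a → R s a a' → Inv (s + 1) a') :
    ∃ I : ℕ → α, Computable I ∧ I 0 = a₀ ∧ ∀ s, Inv s (I s) ∧ R s (I s) (I (s + 1)) := by
  classical
  -- `F (s, a) k` tests whether `k` codes a successor of `a` at step `s`. The search over `k` halts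
  -- because the invariant provides a successor.
  let F : ℕ × α → ℕ → Option α := fun p k =>
    (Encodable.decode (α := α) k).bind fun a' => if R p.1 p.2 a' then some a' else none
  have hF : Computable₂ F := by
    refine Computable.option_bind (g := fun (x : (ℕ × α) × ℕ) a' =>
      if R x.1.1 x.1.2 a' then some a' else none) (Computable.decode.comp Computable.snd) ?_
    refine computable_ite (p := fun y : ((ℕ × α) × ℕ) × α => R y.1.1.1 y.1.1.2 y.2) ?_
      (Computable.option_some.comp Computable.snd) (Computable.const none)
    exact ComputablePred.comp hR
      ((Computable.fst.comp (Computable.fst.comp Computable.fst)).pair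
        ((Computable.snd.comp (Computable.fst.comp Computable.fst)).pair Computable.snd))
  let P : ℕ →. α := fun n => n.rec (Part.some a₀) fun s ih => ih.bind fun a =>
    Nat.rfindOpt (F (s, a))
  have hP : Partrec P := by
    refine Partrec.nat_rec (f := fun n : ℕ => n) (g := fun _ => Part.some a₀)
      (h := fun _ (p : ℕ × α) => Nat.rfindOpt (F (p.1, p.2))) Computable.id
      (Computable.const a₀) ?_
    exact (Partrec.rfindOpt hF).comp Computable.snd
  have hnext : ∀ s a a', a' ∈ Nat.rfindOpt (F (s, a)) → R s a a' := by
    intro s a a' h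
    obtain ⟨k, hk⟩ := Nat.rfindOpt_spec h
    simp only [F, Option.mem_def, Option.bind_eq_some_iff] at hk
    obtain ⟨b, -, hb⟩ := hk
    split_ifs at hb with h'
    cases hb
    exact h'
  have hdom : ∀ s a, Inv s a → ∃ a', a' ∈ Nat.rfindOpt (F (s, a)) := by
    intro s a h
    obtain ⟨a', ha'⟩ := step s a h
    rw [← Part.dom_iff_mem, Nat.rfindOpt_dom]
    exact ⟨Encodable.encode a', a', by simp [F, ha']⟩
  have hex : ∀ n, ∃ a, a ∈ P n ∧ Inv n a := by
    intro n
    induction n with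
    | zero => exact ⟨a₀, Part.mem_some _, h0⟩
    | succ n ih =>
      obtain ⟨a, ha, hi⟩ := ih
      obtain ⟨a', ha'⟩ := hdom n a hi
      exact ⟨a', Part.mem_bind ha ha', pres n a a' hi (hnext _ _ _ ha')⟩
  choose I hI using hex
  refine ⟨I, Partrec.of_eq_tot hP fun n => (hI n).1, ?_, fun s => ⟨(hI s).2, ?_⟩⟩
  · exact Part.mem_unique (hI 0).1 (Part.mem_some _)
  · have h := (hI (s + 1)).1
    obtain ⟨a, ha, hb⟩ := Part.mem_bind_iff.1 h
    rw [Part.mem_unique (hI s).1 ha]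
    exact hnext _ _ _ hb

/-- Unbounded search for a natural number. -/
theorem computable_find {p : α → ℕ → Prop} [∀ a, DecidablePred (p a)]
    (hp : ComputablePred fun x : α × ℕ => p x.1 x.2) (h : ∀ a, ∃ n, p a n) :
    Computable fun a => Nat.find (h a) := by
  have hq : Computable₂ fun a n => decide (p a n) :=
    hp.decide.of_eq fun x => rfl
  refine Partrec.of_eq_tot (Partrec.rfind hq.partrec₂) fun a => ?_
  rw [Nat.mem_rfind]
  refine ⟨by simpa using Nat.find_spec (h a), fun {m} hm => ?_⟩
  simpa using Nat.find_min (h a) hm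

end Toolbox

/-! ### Limit computable approximations of `Δ₂` sets -/

/-- For a convergent approximation, "true from some stage on" (`Σ₂`) and "true at arbitrarily late
stages" (`Π₂`) agree. Writing the stage as `a + b` puts both in the required quantifier form. -/
theorem IsDelta2.of_limit {X : Set ℕ} {G : ℕ → ℕ → Prop}
    (hG : ComputablePred fun p : ℕ × ℕ => G p.1 p.2)
    (h : ∀ n, ∃ s₀, ∀ s ≥ s₀, (G s n ↔ n ∈ X)) : IsDelta2 X := by
  have hc : Computable fun p : ℕ × ℕ × ℕ => (p.2.1 + p.2.2, p.1) :=
    (Primrec.nat_add.to_comp.comp (Computable.fst.comp Computable.snd)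
      (Computable.snd.comp Computable.snd)).pair Computable.fst
  constructor
  · refine ⟨fun n a b => G (a + b) n, ComputablePred.comp hG hc, fun n => ?_⟩
    obtain ⟨s₀, hs⟩ := h n
    constructor
    · exact fun hn => ⟨s₀, fun b => (hs _ (Nat.le_add_right _ _)).2 hn⟩
    · rintro ⟨a, ha⟩
      exact (hs (a + s₀) (Nat.le_add_left _ _)).1 (ha s₀)
  · refine ⟨fun n a b => G (a + b) n, ComputablePred.comp hG hc, fun n => ?_⟩
    obtain ⟨s₀, hs⟩ := h n
    constructor
    · exact fun hn a => ⟨s₀, (hs _ (Nat.le_add_left _ _)).2 hn⟩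
    · intro ha
      obtain ⟨b, hb⟩ := ha s₀
      exact (hs (s₀ + b) (Nat.le_add_right _ _)).1 hb

open Classical in
-- A candidate `a` may witness the `Σ₂` side through `P` or refute the `Π₂` side through `S`. Every
-- candidate below the least genuine one fails both ways at a finite stage, so the least candidate
-- not yet refuted stabilizes. The clause `s ≤ a` only makes the search total.
theorem find_witness_eventually {P S : ℕ → ℕ → Prop}
    (h : (∃ a, ∀ b, P a b) ∨ ∃ a, ∀ b, ¬ S a b)
    (hex : ∀ s, ∃ a, ((∀ b < s, P a b) ∨ (∀ b < s, ¬ S a b)) ∨ s ≤ a) :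
    ∃ a₀ t, ((∀ b, P a₀ b) ∨ (∀ b, ¬ S a₀ b)) ∧ ∀ s ≥ t, Nat.find (hex s) = a₀ := by
  have htrue : ∃ a, (∀ b, P a b) ∨ (∀ b, ¬ S a b) := by
    rcases h with ⟨a, h⟩ | ⟨a, h⟩
    · exact ⟨a, Or.inl h⟩
    · exact ⟨a, Or.inr h⟩
  obtain ⟨t, ht⟩ : ∃ t, ∀ a < Nat.find htrue, ∃ b < t, ∃ b' < t, ¬ P a b ∧ S a b' := by
    have : ∀ m ≤ Nat.find htrue, ∃ t, ∀ a < m, ∃ b < t, ∃ b' < t, ¬ P a b ∧ S a b' := by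
      intro m
      induction m with
      | zero => exact fun _ => ⟨0, fun a ha => absurd ha (Nat.not_lt_zero _)⟩
      | succ m ih =>
        intro hm
        obtain ⟨t, ht⟩ := ih (Nat.le_of_succ_le hm)
        have := Nat.find_min htrue hm
        push Not at this
        obtain ⟨⟨b, hb⟩, ⟨b', hb'⟩⟩ := this
        refine ⟨t + b + b' + 1, fun a ha => ?_⟩
        rcases Nat.lt_succ_iff_lt_or_eq.1 ha with h | rfl
        · obtain ⟨u, hu, u', hu', h⟩ := ht a h
          exact ⟨u, by omega, u', by omega, h⟩
        · exact ⟨b, by omega, b', by omega, hb, hb'⟩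
    exact this _ le_rfl
  -- The stage also exceeds the witness, so that no smaller candidate can be accepted by the clause
  -- `s ≤ a`.
  refine ⟨Nat.find htrue, t + Nat.find htrue + 1, Nat.find_spec htrue, fun s hs => ?_⟩
  rw [Nat.find_eq_iff]
  refine ⟨Or.inl ?_, fun a ha => ?_⟩
  · rcases Nat.find_spec htrue with h | h
    · exact Or.inl fun b _ => h b
    · exact Or.inr fun b _ => h b
  · obtain ⟨b, hb, b', hb', h⟩ := ht a ha
    rintro ((h' | h') | h')
    · exact h.1 (h' b (by omega))
    · exact h' b' (by omega) h.2
    · omega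

theorem IsDelta2.exists_limit {X : Set ℕ} (hX : IsDelta2 X) :
    ∃ G : ℕ → ℕ → Prop, (ComputablePred fun p : ℕ × ℕ => G p.1 p.2) ∧
      ∀ n, ∃ s₀, ∀ s ≥ s₀, (G s n ↔ n ∈ X) := by
  classical
  obtain ⟨⟨R, hR, hRX⟩, ⟨S, hS, hSX⟩⟩ := hX
  let A : ℕ → ℕ → ℕ → Prop := fun s n a => ∀ b < s, R n a b
  let B : ℕ → ℕ → ℕ → Prop := fun s n a => ∀ b < s, ¬ S n a b
  have hq : Computable fun x : ((ℕ × ℕ) × ℕ) × ℕ => (x.1.1.2, x.1.2, x.2) :=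
    (Computable.snd.comp (Computable.fst.comp Computable.fst)).pair
      ((Computable.snd.comp Computable.fst).pair Computable.snd)
  have hA : ComputablePred fun x : (ℕ × ℕ) × ℕ => A x.1.1 x.1.2 x.2 :=
    ComputablePred.forall_lt (p := fun (x : (ℕ × ℕ) × ℕ) b => R x.1.2 x.2 b)
      (Computable.fst.comp Computable.fst) (ComputablePred.comp hR hq)
  have hB : ComputablePred fun x : (ℕ × ℕ) × ℕ => B x.1.1 x.1.2 x.2 :=
    ComputablePred.forall_lt (p := fun (x : (ℕ × ℕ) × ℕ) b => ¬ S x.1.2 x.2 b)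
      (Computable.fst.comp Computable.fst) (ComputablePred.comp (p := fun y : ℕ × ℕ × ℕ => ¬ S y.1 y.2.1 y.2.2) hS.not hq)
  let Q : ℕ × ℕ → ℕ → Prop := fun x a => (A x.1 x.2 a ∨ B x.1 x.2 a) ∨ x.1 ≤ a
  have hQ : ComputablePred fun x : (ℕ × ℕ) × ℕ => Q x.1 x.2 :=
    ComputablePred.or (ComputablePred.or hA hB)
      (ComputablePred.le (Computable.fst.comp Computable.fst) Computable.snd)
  have hex : ∀ x, ∃ a, Q x a := fun x => ⟨x.1, Or.inr le_rfl⟩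
  have hfind := computable_find hQ hex
  refine ⟨fun s n => A s n (Nat.find (hex (s, n))),
    ComputablePred.comp hA (Computable.id.pair hfind), fun n => ?_⟩
  have htrue : (∃ a, ∀ b, R n a b) ∨ ∃ a, ∀ b, ¬ S n a b := by
    by_cases hn : n ∈ X
    · exact Or.inl ((hRX n).1 hn)
    · rw [hSX] at hn
      push Not at hn
      exact Or.inr hn
  obtain ⟨a₀, t, ha₀, hfound⟩ := find_witness_eventually htrue fun s => hex (s, n)
  by_cases hn : n ∈ X
  · have h1 : ∀ b, R n a₀ b := by
      rcases ha₀ with h | h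
      · exact h
      · obtain ⟨b, hb⟩ := (hSX n).1 hn a₀
        exact absurd hb (h b)
    refine ⟨t, fun s hs => ?_⟩
    simp only [hfound s hs, hn, iff_true]
    exact fun b _ => h1 b
  · have h1 : ∃ b, ¬ R n a₀ b := by
      by_contra! hc
      exact hn ((hRX n).2 ⟨a₀, hc⟩)
    obtain ⟨b, hb⟩ := h1
    refine ⟨t + b + 1, fun s hs => ?_⟩
    simp only [hfound s (by omega), hn, iff_false]
    exact fun h => hb (h b (by omega))

/-- A `Δ₂` set is given by a computable mind change counter: the parity of the final number of
changes decides membership. -/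
theorem IsDelta2.exists_counter {X : Set ℕ} (hX : IsDelta2 X) :
    ∃ c : ℕ → ℕ → ℕ, Computable₂ c ∧ (∀ s n, c s n ≤ c (s + 1) n) ∧
      ∀ n, ∃ s₀, ∀ s ≥ s₀, c s n = c s₀ n ∧ (c s n % 2 = 1 ↔ n ∈ X) := by
  classical
  obtain ⟨G, hG, hlim⟩ := hX.exists_limit
  -- The counter goes up exactly when its parity disagrees with the current guess.
  let c : ℕ → ℕ → ℕ := fun s n => Nat.rec (motive := fun _ => ℕ) 0
    (fun s k => if (k % 2 = 1 ↔ G s n) then k else k + 1) s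
  have hsucc : ∀ s n, c (s + 1) n = if (c s n % 2 = 1 ↔ G s n) then c s n else c s n + 1 :=
    fun s n => rfl
  have hpar : ∀ s n, c (s + 1) n % 2 = 1 ↔ G s n := by
    intro s n
    rw [hsucc]
    split_ifs with h
    · exact h
    · by_cases hg : G s n <;> simp only [hg, iff_true, iff_false] at h ⊢ <;> omega
  refine ⟨c, ?_, fun s n => ?_, fun n => ?_⟩
  · refine Computable.nat_rec (f := fun p : ℕ × ℕ => p.1) (g := fun _ => 0)
      (h := fun p (q : ℕ × ℕ) => if (q.2 % 2 = 1 ↔ G q.1 p.2) then q.2 else q.2 + 1)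
      Computable.fst (Computable.const 0) ?_
    have hk : Computable fun x : (ℕ × ℕ) × ℕ × ℕ => x.2.2 :=
      Computable.snd.comp Computable.snd
    refine computable_ite (p := fun x : (ℕ × ℕ) × ℕ × ℕ => (x.2.2 % 2 = 1 ↔ G x.2.1 x.1.2))
      (ComputablePred.iff (ComputablePred.eq
        (Primrec.nat_mod.to_comp.comp hk (Computable.const 2)) (Computable.const 1)) ?_)
      hk (Computable.succ.comp hk)
    exact ComputablePred.comp hG ((Computable.fst.comp Computable.snd).pair
      (Computable.snd.comp Computable.fst))
  · rw [hsucc]; split_ifs <;> omega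
  · obtain ⟨s₀, hs⟩ := hlim n
    have key : ∀ s ≥ s₀, c (s + 1) n = c (s₀ + 1) n ∧ (c (s + 1) n % 2 = 1 ↔ n ∈ X) := by
      intro s h
      induction s, h using Nat.le_induction with
      | base => exact ⟨rfl, (hpar s₀ n).trans (hs s₀ le_rfl)⟩
      | succ s h ih =>
        refine ⟨?_, (hpar (s + 1) n).trans (hs (s + 1) (by omega))⟩
        rw [hsucc (s + 1), if_pos (ih.2.trans (hs (s + 1) (by omega)).symm), ih.1]
    refine ⟨s₀ + 1, fun s h => ?_⟩
    obtain ⟨s, rfl⟩ := Nat.exists_eq_add_of_lt (Nat.lt_of_succ_le h)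
    exact key (s₀ + s) (by omega)

/-- The image of a computable function in a computable copy of `(ω, <)` is `Δ₂`. -/
theorem dgSp_subset_delta2Degrees {f : ℕ → ℕ} (hf : Computable f) :
    DgSp f ⊆ delta2Degrees := by
  classical
  rintro d ⟨r, ⟨hr, -⟩, φ, rfl⟩
  refine ⟨_, ?_, rfl⟩
  -- The predecessors of `a` seen among the numbers below `s`; the count settles at the position of
  -- `a`.
  let cnt : ℕ → ℕ → ℕ := fun s a => ((List.range s).filter (fun x => r x a)).length
  have hcnt : Computable₂ cnt :=
    Computable.list_length.comp (computable_list_filter (p := fun (y : ℕ × ℕ) x => r x y.2)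
      (Primrec.list_range.to_comp.comp Computable.fst)
      (ComputablePred.comp hr (Computable.snd.pair (Computable.snd.comp Computable.fst))))
  have hlim : ∀ a, ∃ s₀, ∀ s ≥ s₀, cnt s a = φ.symm a := by
    intro a
    obtain ⟨s₀, hs₀⟩ : ∃ s₀, ∀ m < φ.symm a, φ m < s₀ := by
      obtain ⟨b, hb⟩ := ((Set.finite_Iio (φ.symm a)).image φ).bddAbove
      exact ⟨b + 1, fun m hm => Nat.lt_succ_of_le (hb ⟨m, hm, rfl⟩)⟩
    refine ⟨s₀, fun s hs => ?_⟩
    have hnd : ((List.range s).filter (fun x => r x a)).Nodup := List.nodup_range.filter _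
    have : ((List.range s).filter (fun x => r x a)).toFinset
        = (Finset.range (φ.symm a)).image φ := by
      ext x
      simp only [List.mem_toFinset, List.mem_filter, List.mem_range, decide_eq_true_eq,
        Finset.mem_image, Finset.mem_range]
      constructor
      · rintro ⟨-, hx⟩
        refine ⟨φ.symm x, ?_, by simp⟩
        rw [← φ.map_rel_iff]; simpa using hx
      · rintro ⟨m, hm, rfl⟩
        refine ⟨lt_of_lt_of_le (hs₀ m hm) hs, ?_⟩
        have := φ.map_rel_iff.2 hm
        simpa using this
    change ((List.range s).filter (fun x => r x a)).length = _
    rw [← List.toFinset_card_of_nodup hnd, this, Finset.card_image_of_injective _ φ.injective,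
      Finset.card_range]
  refine IsDelta2.of_limit (G := fun s n => f (cnt s n.unpair.1) = cnt s n.unpair.2) ?_ fun n => ?_
  · refine ComputablePred.eq (hf.comp (hcnt.comp Computable.fst
      (Computable.fst.comp (Computable.unpair.comp Computable.snd)))) (hcnt.comp Computable.fst
      (Computable.snd.comp (Computable.unpair.comp Computable.snd)))
  · obtain ⟨s₁, h₁⟩ := hlim n.unpair.1
    obtain ⟨s₂, h₂⟩ := hlim n.unpair.2
    refine ⟨max s₁ s₂, fun s hs => ?_⟩
    rw [h₁ s (le_trans (le_max_left _ _) hs), h₂ s (le_trans (le_max_right _ _) hs)]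
    simp only [Set.mem_ofPred_eq, Relation.Map]
    constructor
    · exact fun h => ⟨_, _, h, by simp, by simp⟩
    · rintro ⟨x, y, h, hx, hy⟩
      rw [← hx, ← hy]; simpa using h

/-! ### Cuts of a block function -/

/-- `q` is a cut of `f`: both `{x | x < q}` and its complement are closed under `f`. -/
def IsCut (f : ℕ → ℕ) (q : ℕ) : Prop := ∀ x, f x < q ↔ x < q

theorem isCut_zero (f : ℕ → ℕ) : IsCut f 0 := fun x => by simp

theorem IsClosedInterval.inter {f : ℕ → ℕ} {I J : Set ℕ} (hI : IsClosedInterval f I)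
    (hJ : IsClosedInterval f J) : IsClosedInterval f (I ∩ J) :=
  ⟨hI.1.inter_of_left _, hI.2.1.inter hJ.2.1, fun x hx => ⟨hI.2.2.1 x hx.1, hJ.2.2.1 x hx.2⟩,
    fun x hx => ⟨hI.2.2.2 x hx.1, hJ.2.2.2 x hx.2⟩⟩

theorem exists_isBlockOf {f : ℕ → ℕ} (hf : IsBlockFunction f) (a : ℕ) :
    ∃ I, IsBlockOf f a I := by
  obtain ⟨J, haJ, hJ⟩ := hf a
  refine ⟨⋂₀ {I | a ∈ I ∧ IsClosedInterval f I}, ⟨⟨?_, ?_, ?_, ?_, ?_⟩, ?_⟩⟩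
  · exact fun I hI => hI.1
  · exact hJ.1.subset (Set.sInter_subset_of_mem ⟨haJ, hJ⟩)
  · exact Set.ordConnected_sInter fun I hI => hI.2.2.1
  · exact fun x hx I hI => hI.2.2.2.1 x (hx I hI)
  · exact fun x hx I hI => hI.2.2.2.2 x (hx I hI)
  · exact fun I hI => Set.sInter_subset_of_mem hI

/-- Isomorphic blocks have the same size, so size is a function on the finite set of types. -/
theorem exists_block_bound {f : ℕ → ℕ} (h : Finite (FType f)) :
    ∃ K, ∀ a I, IsBlockOf f a I → I.ncard ≤ K := by
  let s : Setoid (FBlock f) := Setoid.mk (BlockIso f) (blockIso_equivalence f)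
  let card : FType f → ℕ := Quotient.lift (s := s) (fun I => I.1.ncard) (by
    rintro I J ⟨e, -⟩
    exact Nat.card_congr e.toEquiv)
  obtain ⟨K, hK⟩ := (Set.finite_range card).bddAbove
  refine ⟨K, fun a I hI => ?_⟩
  exact hK ⟨Quotient.mk s ⟨I, a, hI⟩, rfl⟩

/-- Blocks may be nested, so one takes a largest block containing `a`; the point just after its
maximum is a cut, and it is near `a` because block sizes are bounded. -/
theorem exists_cut_bound {f : ℕ → ℕ} (hf : IsBlockFunction f) (h : Finite (FType f)) :
    ∃ K, ∀ a, ∃ q, a < q ∧ q ≤ a + K ∧ IsCut f q := by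
  classical
  obtain ⟨K, hK⟩ := exists_block_bound h
  choose B hB using exists_isBlockOf hf
  have hleast : ∀ z J, z ∈ J ∧ IsClosedInterval f J → B z ⊆ J := fun z J hJ => (hB z).2 hJ
  refine ⟨K, fun a => ?_⟩
  -- a largest block containing `a`
  obtain ⟨y, hay, hmax⟩ : ∃ y, a ∈ B y ∧ ∀ x, a ∈ B x → (B x).ncard ≤ (B y).ncard := by
    let T : Set ℕ := {n | ∃ y, a ∈ B y ∧ (B y).ncard = n}
    have hne : T.Nonempty := ⟨_, a, (hB a).1.1, rfl⟩
    have hbd : BddAbove T := ⟨K, by rintro n ⟨y, -, rfl⟩; exact hK y _ (hB y)⟩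
    obtain ⟨y, hy, hyn⟩ := Nat.sSup_mem hne hbd
    exact ⟨y, hy, fun x hx => hyn ▸ le_csSup hbd ⟨x, hx, rfl⟩⟩
  have hfin : (B y).Finite := (hB y).1.2.1
  obtain ⟨m, hm, hmle⟩ : ∃ m ∈ B y, ∀ x ∈ B y, x ≤ m := by
    obtain ⟨m, hm, h⟩ := Set.exists_max_image (B y) id hfin ⟨a, hay⟩
    exact ⟨m, hm, h⟩
  -- No block straddles `m` and `m + 1`. If it contained `y` it would be a larger block around `a`;
  -- otherwise removing it from `B y` would leave a smaller closed interval around `y`.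
  have span : ∀ z, m ∈ B z → m + 1 ∈ B z → False := by
    intro z h1 h2
    have hyz : y ∈ B z := by
      by_contra hy
      have hcl : IsClosedInterval f (B y \ B z) := by
        refine ⟨hfin.subset Set.sdiff_subset, ⟨?_⟩, ?_, ?_⟩
        · rintro u ⟨hu, hu'⟩ w ⟨hw, hw'⟩ v ⟨huv, hvw⟩
          refine ⟨(hB y).1.2.2.1.out hu hw ⟨huv, hvw⟩, fun hv => hw' ?_⟩
          exact (hB z).1.2.2.1.out hv h1 ⟨hvw, hmle w hw⟩
        · rintro x ⟨hx, hx'⟩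
          exact ⟨(hB y).1.2.2.2.1 x hx, fun h => hx' ((hB z).1.2.2.2.2 x h)⟩
        · rintro x ⟨hx, hx'⟩
          exact ⟨(hB y).1.2.2.2.2 x hx, fun h => hx' ((hB z).1.2.2.2.1 x h)⟩
      have hle : B y ⊆ B y \ B z := hleast y _ ⟨⟨(hB y).1.1, hy⟩, hcl⟩
      exact (hle hm).2 h1
    have hsub : B y ⊆ B z := hleast y _ ⟨hyz, (hB z).1.2⟩
    have hss : B y ⊂ B z := ⟨hsub, fun h => absurd (hmle _ (h h2)) (by omega)⟩
    have := Set.ncard_lt_ncard hss (hB z).1.2.1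
    have := hmax z (hsub hay)
    omega
  refine ⟨m + 1, Nat.lt_succ_of_le (hmle a hay), ?_, fun x => ?_⟩
  · have hsub : Set.Icc a m ⊆ B y := (hB y).1.2.2.1.out hay hm
    have h1 := Set.ncard_le_ncard hsub hfin
    have h2 := hK y _ (hB y)
    have h3 : (Set.Icc a m).ncard = m + 1 - a := by
      rw [← Finset.coe_Icc, Set.ncard_coe_finset, Nat.card_Icc]
    omega
  · have hx := (hB x).1.1
    have hfx := (hB x).1.2.2.2.1 x hx
    have hoc := (hB x).1.2.2.1
    by_contra hne
    rcases lt_or_ge x (m + 1) with h | h <;> rcases lt_or_ge (f x) (m + 1) with h' | h'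
    · exact hne ⟨fun _ => h, fun _ => h'⟩
    · exact span x (hoc.out hx hfx ⟨by omega, by omega⟩) (hoc.out hx hfx ⟨by omega, by omega⟩)
    · exact span x (hoc.out hfx hx ⟨by omega, by omega⟩) (hoc.out hfx hx ⟨by omega, by omega⟩)
    · exact hne ⟨fun _ => absurd h' (by omega), fun _ => absurd h (by omega)⟩

/-! ### Words -/

/-- The word `U` occurs at `q`: `f` maps `q + t` to `q + U[t]`, between two cuts of `f`. -/
def Occ (f : ℕ → ℕ) (q : ℕ) (U : List ℕ) : Prop :=
  IsCut f q ∧ IsCut f (q + U.length) ∧ ∀ t < U.length, f (q + t) = q + U.getD t 0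

/-- The word `U` occurs infinitely often. -/
def IsRec (f : ℕ → ℕ) (U : List ℕ) : Prop := ∀ N, ∃ q ≥ N, Occ f q U

/-- The word between `q` and `q + l`. -/
def wordAt (f : ℕ → ℕ) (q l : ℕ) : List ℕ := (List.range l).map fun t => f (q + t) - q

@[simp] theorem length_wordAt (f : ℕ → ℕ) (q l : ℕ) : (wordAt f q l).length = l := by
  simp [wordAt]

theorem wordAt_getD {f : ℕ → ℕ} {q l t : ℕ} (ht : t < l) :
    (wordAt f q l).getD t 0 = f (q + t) - q := by
  simp [wordAt, List.getD, ht]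

theorem IsCut.le_apply {f : ℕ → ℕ} {q : ℕ} (h : IsCut f q) {x : ℕ} (hx : q ≤ x) : q ≤ f x := by
  by_contra hlt
  exact absurd ((h x).1 (not_le.1 hlt)) (by omega)

theorem occ_wordAt {f : ℕ → ℕ} {q l : ℕ} (h : IsCut f q) (h' : IsCut f (q + l)) :
    Occ f q (wordAt f q l) := by
  refine ⟨h, by simpa using h', fun t ht => ?_⟩
  rw [length_wordAt] at ht
  rw [wordAt_getD ht]
  have := h.le_apply (x := q + t) (by omega)
  omega

theorem Occ.getD_lt {f : ℕ → ℕ} {q : ℕ} {U : List ℕ} (h : Occ f q U) {t : ℕ}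
    (ht : t < U.length) : U.getD t 0 < U.length := by
  have h1 := (h.2.1 (q + t)).2 (by omega)
  rw [h.2.2 t ht] at h1
  omega

theorem finite_bounded_lists (M : ℕ) :
    {U : List ℕ | U.length ≤ M ∧ ∀ x ∈ U, x < M}.Finite := by
  refine ((List.finite_length_le (Fin M) M).image (List.map Fin.val)).subset ?_
  rintro U ⟨hl, hU⟩
  refine ⟨U.pmap (fun x hx => (⟨x, hx⟩ : Fin M)) hU, ?_, ?_⟩
  · simpa using hl
  · simp [List.map_pmap]

theorem Occ.mem_bounded {f : ℕ → ℕ} {q M : ℕ} {U : List ℕ} (h : Occ f q U)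
    (hU : U.length ≤ M) : U ∈ {U : List ℕ | U.length ≤ M ∧ ∀ x ∈ U, x < M} := by
  refine ⟨hU, fun x hx => ?_⟩
  obtain ⟨t, ht, rfl⟩ := List.getElem_of_mem hx
  have := h.getD_lt ht
  rw [List.getD_eq_getElem _ _ ht] at this
  omega

/-- Only finitely many words of length at most `M` can occur, and each nonrecurring one has a last
occurrence. -/
theorem exists_forall_occ_isRec (f : ℕ → ℕ) (M : ℕ) :
    ∃ N, ∀ U : List ℕ, U.length ≤ M → ∀ q ≥ N, Occ f q U → IsRec f U := by
  have hN : ∀ U, ∃ N, ∀ q ≥ N, Occ f q U → IsRec f U := by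
    intro U
    by_cases h : IsRec f U
    · exact ⟨0, fun _ _ _ => h⟩
    · unfold IsRec at h
      push Not at h
      obtain ⟨N, hN⟩ := h
      exact ⟨N, fun q hq ho => absurd ho (hN q hq)⟩
  choose g hg using hN
  obtain ⟨N, hN⟩ := ((finite_bounded_lists M).image g).bddAbove
  refine ⟨N, fun U hU q hq ho => hg U q (le_trans (hN ⟨U, ho.mem_bounded hU, rfl⟩) hq) ho⟩

/-! ### Recurring words when the gaps between cuts are bounded -/

section Bounded

variable {f : ℕ → ℕ} {K : ℕ}

theorem apply_lt_add (hK : ∀ a, ∃ q, a < q ∧ q ≤ a + K ∧ IsCut f q) (x : ℕ) :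
    f x < x + K ∧ x < f x + K := by
  obtain ⟨q, h1, h2, h3⟩ := hK x
  obtain ⟨q', h1', h2', h3'⟩ := hK (f x)
  exact ⟨lt_of_lt_of_le ((h3 x).2 h1) h2, lt_of_lt_of_le ((h3' x).1 h1') h2'⟩

/-- Since `f` moves points by less than `K`, points beyond `q + K` cannot violate the condition.
This makes being a cut decidable. -/
theorem isCut_iff_bounded (hK : ∀ a, ∃ q, a < q ∧ q ≤ a + K ∧ IsCut f q) (q : ℕ) :
    IsCut f q ↔ ∀ x < q + K, (f x < q ↔ x < q) := by
  refine ⟨fun h x _ => h x, fun h x => ?_⟩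
  rcases lt_or_ge x (q + K) with hx | hx
  · exact h x hx
  · have := (apply_lt_add hK x).2
    constructor <;> intro <;> omega

/-- Recurring words are determined by their lengths. -/
def UniqueRec (f : ℕ → ℕ) : Prop :=
  ∀ U U' : List ℕ, U.length = U'.length → IsRec f U → IsRec f U' → U = U'

/-- Among `K + 1` successive cuts, two are followed by words of equal length a little over `M`.
These words recur, hence coincide, so `f` repeats itself after the distance between the two cuts.
The bound on the period does not depend on `M`. -/
theorem exists_local_period (hK : ∀ a, ∃ q, a < q ∧ q ≤ a + K ∧ IsCut f q)
    (hu : UniqueRec f) (M N : ℕ) : ∃ q ≥ N, ∃ P, 0 < P ∧ P ≤ K * K ∧ IsCut f q ∧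
      IsCut f (q + P) ∧ ∀ t < M, f (q + P + t) = f (q + t) + P := by
  classical
  obtain ⟨N', hN'⟩ := exists_forall_occ_isRec f (M + K)
  choose nx hlt hle hcut using hK
  let Q : ℕ → ℕ := fun i => nx^[i] (nx (N + N'))
  have hQs : ∀ i, Q (i + 1) = nx (Q i) := fun i => Function.iterate_succ_apply' nx i _
  have hQcut : ∀ i, IsCut f (Q i) := by
    intro i
    cases i with
    | zero => exact hcut _
    | succ i => rw [hQs]; exact hcut _
  have hmono : StrictMono Q := strictMono_nat_of_lt_succ fun i => by rw [hQs]; exact hlt _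
  have hQN : ∀ i, N + N' < Q i := fun i =>
    lt_of_lt_of_le (hlt _) (hmono.monotone (Nat.zero_le i))
  have hQle : ∀ i d, Q (i + d) ≤ Q i + d * K := by
    intro i d
    induction d with
    | zero => simp
    | succ d ih =>
      rw [← Nat.add_assoc, hQs, Nat.succ_mul]
      have := hle (Q (i + d))
      omega
  -- The length from `Q i` to a cut beyond `Q i + M`; it takes one of the `K` values from `M + 1` to
  -- `M + K`.
  let e : ℕ → ℕ := fun i => nx (Q i + M) - Q i
  have he : ∀ i, M < e i ∧ e i ≤ M + K ∧ IsCut f (Q i + e i) := by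
    intro i
    have h1 := hlt (Q i + M)
    have h2 := hle (Q i + M)
    refine ⟨by simp only [e]; omega, by simp only [e]; omega, ?_⟩
    have : Q i + e i = nx (Q i + M) := by simp only [e]; omega
    rw [this]
    exact hcut _
  obtain ⟨i, hi, j, hj, hne, hij⟩ := Finset.exists_ne_map_eq_of_card_lt_of_maps_to
    (s := Finset.range (K + 1)) (t := Finset.Icc (M + 1) (M + K)) (f := e)
    (by simp) (fun i _ => by
      simp only [Finset.coe_Icc, Set.mem_Icc]
      exact ⟨(he i).1, (he i).2.1⟩)
  wlog hlt' : i < j generalizing i j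
  · exact this j hj i hi hne.symm hij.symm (by omega)
  simp only [Finset.mem_range] at hi hj
  have hwi := occ_wordAt (hQcut i) (he i).2.2
  have hwj := occ_wordAt (hQcut j) (he j).2.2
  have heq : wordAt f (Q i) (e i) = wordAt f (Q j) (e j) := by
    refine hu _ _ (by simpa using hij) (hN' _ (by simpa using (he i).2.1) (Q i) ?_ hwi)
      (hN' _ (by simpa using (he j).2.1) (Q j) ?_ hwj)
    · have := hQN i; omega
    · have := hQN j; omega
  have hQij := hmono hlt'
  refine ⟨Q i, by have := hQN i; omega, Q j - Q i, by omega, ?_, hQcut i, ?_, fun t ht => ?_⟩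
  · have := hQle i (j - i)
    rw [show i + (j - i) = j by omega] at this
    have h2 : (j - i) * K ≤ K * K := Nat.mul_le_mul_right _ (by omega)
    omega
  · rw [show Q i + (Q j - Q i) = Q j by omega]; exact hQcut j
  · have h1 := hwi.2.2 t (by simpa using (he i).1.trans' ht)
    have h2 := hwj.2.2 t (by simpa using (he j).1.trans' ht)
    rw [← heq] at h2
    rw [show Q i + (Q j - Q i) + t = Q j + t by omega, h1, h2]
    omega

/-- The `k`-fold repetition of the word `V`. -/
def powWord (V : List ℕ) (k : ℕ) : List ℕ :=
  (List.range (k * V.length)).map fun t => t / V.length * V.length + V.getD (t % V.length) 0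

@[simp] theorem length_powWord (V : List ℕ) (k : ℕ) :
    (powWord V k).length = k * V.length := by
  simp [powWord]

theorem powWord_getD {V : List ℕ} {k t : ℕ} (ht : t < k * V.length) :
    (powWord V k).getD t 0 = t / V.length * V.length + V.getD (t % V.length) 0 := by
  simp [powWord, List.getD, ht]

/-- Periods are bounded while the stretch on which they hold is arbitrarily long, so by finiteness a
single word `V` serves as period on arbitrarily long, arbitrarily late stretches. -/
theorem exists_isRec_powWord (hK : ∀ a, ∃ q, a < q ∧ q ≤ a + K ∧ IsCut f q)
    (hu : UniqueRec f) : ∃ V : List ℕ, 0 < V.length ∧ ∀ k, IsRec f (powWord V k) := by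
  let Pr : List ℕ → ℕ → Prop := fun V M => 0 < V.length ∧ ∃ q ≥ M, Occ f q V ∧
    ∀ t < M, f (q + V.length + t) = f (q + t) + V.length
  have hanti : ∀ V M M', M ≤ M' → Pr V M' → Pr V M := by
    rintro V M M' hM ⟨h0, q, hq, ho, ht⟩
    exact ⟨h0, q, hM.trans hq, ho, fun t h => ht t (h.trans_le hM)⟩
  obtain ⟨V, hV⟩ : ∃ V, ∀ M, Pr V M := by
    by_contra! hcon
    choose g hg using hcon
    obtain ⟨B, hB⟩ := ((finite_bounded_lists (K * K)).image g).bddAbove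
    obtain ⟨q, hq, P, hP, hPK, hc, hc', hper⟩ := exists_local_period hK hu B B
    have ho := occ_wordAt hc hc'
    have hle : g (wordAt f q P) ≤ B := hB ⟨_, ho.mem_bounded (by simpa using hPK), rfl⟩
    refine hg _ (hanti _ _ _ hle ⟨by simpa using hP, q, hq, ho, fun t ht => ?_⟩)
    simpa using hper t ht
  refine ⟨V, (hV 0).1, fun k N => ?_⟩
  have hP := (hV 0).1
  set P := V.length with hPdef
  -- The stretch starts past `N` and covers `k` copies of `V`. The margin `K` ensures that points
  -- beyond it are not mapped below the cuts in question.
  obtain ⟨-, q, hq, ho, hper⟩ := hV (N + k * P + P + K)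
  have hcuts : ∀ i, i ≤ k → IsCut f (q + i * P) := by
    intro i
    induction i with
    | zero => exact fun _ => by simpa using ho.1
    | succ i ih =>
      intro hi x
      have hci := ih (by omega)
      have hik : (i + 1) * P ≤ k * P := Nat.mul_le_mul_right _ hi
      rw [Nat.succ_mul] at hik ⊢
      rcases lt_or_ge x (q + P) with hx | hx
      · have := (ho.2.1 x).2 hx
        constructor <;> intro <;> omega
      · obtain ⟨t, rfl⟩ := Nat.exists_eq_add_of_le hx
        rcases lt_or_ge t (N + k * P + P + K) with ht | ht
        · rw [hper t ht]
          have := hci (q + t)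
          constructor <;> intro <;> omega
        · have := (apply_lt_add hK (q + P + t)).2
          constructor <;> intro <;> omega
  have hval : ∀ i < k, ∀ t < P, f (q + i * P + t) = q + i * P + V.getD t 0 := by
    intro i
    induction i with
    | zero => intro _ t ht; simpa using ho.2.2 t ht
    | succ i ih =>
      intro hi t ht
      have hik : (i + 1) * P ≤ k * P := Nat.mul_le_mul_right _ hi.le
      rw [Nat.succ_mul] at hik ⊢
      have h1 := ih (by omega) t ht
      have h2 := hper (i * P + t) (by omega)
      rw [show q + P + (i * P + t) = q + (i * P + P) + t by omega,
        show q + (i * P + t) = q + i * P + t by omega, h1] at h2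
      omega
  refine ⟨q, by omega, ho.1, by simpa using hcuts k le_rfl, fun t ht => ?_⟩
  rw [length_powWord] at ht
  rw [powWord_getD ht]
  have h1 := hval (t / P) (Nat.div_lt_of_lt_mul (by rwa [Nat.mul_comm])) (t % P)
    (Nat.mod_lt _ hP)
  rw [Nat.add_assoc, Nat.mul_comm, Nat.div_add_mod] at h1
  rw [h1, Nat.mul_comm, Nat.add_assoc]

theorem exists_nontrivial_isRec (hK : ∀ a, ∃ q, a < q ∧ q ≤ a + K ∧ IsCut f q)
    (hid : ¬ IsAlmostIdentity f) :
    ∃ U : List ℕ, IsRec f U ∧ ∃ t < U.length, U.getD t 0 ≠ t := by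
  obtain ⟨N, hN⟩ := exists_forall_occ_isRec f (2 * K)
  -- A moved point this far out lies between two cuts past `N` at distance at most `2 * K`, so the
  -- word between them recurs.
  obtain ⟨x, hx, hxN⟩ := (Set.not_finite.1 hid).exists_gt (N + K)
  obtain ⟨q, h1, h2, h3⟩ := hK (x - K - 1)
  obtain ⟨q', h1', h2', h3'⟩ := hK x
  have hqx : q ≤ x := by omega
  have ho := occ_wordAt (l := q' - q) h3 (by rwa [show q + (q' - q) = q' by omega])
  refine ⟨_, hN _ (by simp; omega) q (by omega) ho, x - q, by simp; omega, fun h => hx ?_⟩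
  have := ho.2.2 (x - q) (by simp; omega)
  rw [h, show q + (x - q) = x by omega] at this
  exact this

/-- Either two different recurring words have the same length, or some nontrivial word can be
repeated arbitrarily often. -/
theorem isRec_dichotomy (hK : ∀ a, ∃ q, a < q ∧ q ≤ a + K ∧ IsCut f q)
    (hid : ¬ IsAlmostIdentity f) :
    (∃ U U' : List ℕ, U.length = U'.length ∧ U ≠ U' ∧ IsRec f U ∧ IsRec f U') ∨
    ∃ V : List ℕ, 0 < V.length ∧ (∃ t < V.length, V.getD t 0 ≠ t) ∧
      ∀ k, IsRec f (powWord V k) := by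
  by_cases hu : UniqueRec f
  · right
    obtain ⟨V, hV0, hV⟩ := exists_isRec_powWord hK hu
    refine ⟨V, hV0, ?_, hV⟩
    by_contra! htriv
    obtain ⟨U, hU, t, ht, hne⟩ := exists_nontrivial_isRec hK hid
    -- If `V` were an identity word, identity words of every length would recur, and uniqueness
    -- would make the nontrivial recurring word `U` one of them.
    have hrange : IsRec f (List.range U.length) := by
      intro N
      obtain ⟨q, hq, ho⟩ := hV U.length N
      have hlen : U.length ≤ U.length * V.length := Nat.le_mul_of_pos_right _ hV0
      have hfix : ∀ t < U.length * V.length, f (q + t) = q + t := by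
        intro t ht
        have := ho.2.2 t (by simpa using ht)
        rw [powWord_getD ht, htriv _ (Nat.mod_lt _ hV0), Nat.mul_comm, Nat.div_add_mod] at this
        exact this
      refine ⟨q, hq, ho.1, fun x => ?_, fun t ht => ?_⟩
      · rw [List.length_range]
        rcases lt_or_ge x q with hx | hx
        · have := (ho.1 x).2 hx
          constructor <;> intro <;> omega
        · obtain ⟨t, rfl⟩ := Nat.exists_eq_add_of_le hx
          rcases lt_or_ge t (U.length * V.length) with ht | ht
          · rw [hfix t ht]
          · have := ho.2.1.le_apply (x := q + t) (by simp; omega)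
            rw [length_powWord] at this
            constructor <;> intro <;> omega
      · rw [List.length_range] at ht
        rw [hfix t (by omega)]
        simp [List.getD, ht]
    have := hu U _ (by simp) hU hrange
    rw [this] at hne
    simp [List.getD, ht] at hne
  · left
    unfold UniqueRec at hu
    push Not at hu
    obtain ⟨U, U', h1, h2, h3, h4⟩ := hu
    exact ⟨U, U', h1, h4, h2, h3⟩

end Bounded

/-! ### Coding gadgets -/

/-- A coding gadget: lists `E c` of elements, growing with the number `c` of mind changes, which
are placed at occurrences of the recurring word `W c`. The induced map `h` on elements depends
only on the parity of `c`, and it takes different values at `z` for the two parities. -/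
structure CodingGadget (f : ℕ → ℕ) where
  E : ℕ → List ℕ
  W : ℕ → List ℕ
  h : ℕ → ℕ → ℕ
  z : ℕ
  computable_E : Computable E
  computable_W : Computable W
  computable_h : Computable₂ h
  length_eq : ∀ c, (E c).length = (W c).length
  nodup : ∀ c, (E c).Nodup
  sublist : ∀ c, (E c).Sublist (E (c + 1))
  map_eq : ∀ c, ∀ t < (E c).length,
    (E c)[(W c).getD t 0]? = some (h (c % 2) ((E c).getD t 0))
  isRec : ∀ c, IsRec f (W c)
  z_mem : z ∈ E 0
  h_ne : h 0 z ≠ h 1 z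

theorem exists_getD_ne {U U' : List ℕ} (hl : U.length = U'.length) (hne : U ≠ U') :
    ∃ t < U.length, U.getD t 0 ≠ U'.getD t 0 := by
  by_contra! hcon
  refine hne (List.ext_getElem hl fun t h h' => ?_)
  have := hcon t h
  rwa [List.getD_eq_getElem _ _ h, List.getD_eq_getElem _ _ h'] at this

theorem computable_list_getD : Computable₂ fun (l : List ℕ) n => l.getD n 0 :=
  (Primrec.list_getD 0).to_comp

theorem CodingGadget.nonempty_of_two_words {f : ℕ → ℕ} {U U' : List ℕ}
    (hl : U.length = U'.length) (hne : U ≠ U') (hU : IsRec f U) (hU' : IsRec f U') :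
    Nonempty (CodingGadget f) := by
  obtain ⟨z, hz, hzne⟩ := exists_getD_ne hl hne
  have hparity : ComputablePred fun c : ℕ => c % 2 = 0 :=
    ComputablePred.eq (Primrec.nat_mod.to_comp.comp Computable.id (Computable.const 2))
      (Computable.const 0)
  let w : ℕ → List ℕ := fun c => if c % 2 = 0 then U else U'
  have hw : Computable w :=
    computable_ite hparity (Computable.const U) (Computable.const U')
  have hwl : ∀ c, (w c).length = U.length := fun c => by
    simp only [w]; split_ifs <;> simp [hl]
  have hrec : ∀ c, IsRec f (w c) := fun c => by
    simp only [w]; split_ifs <;> assumption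
  refine ⟨{
    E := fun _ => List.range U.length
    W := w
    h := fun b i => (w b).getD i 0
    z := z
    computable_E := Computable.const _
    computable_W := hw
    computable_h := computable_list_getD.comp (hw.comp Computable.fst) Computable.snd
    length_eq := fun c => by simp [hwl]
    nodup := fun c => List.nodup_range
    sublist := fun c => List.Sublist.refl _
    map_eq := fun c t ht => ?_
    isRec := hrec
    z_mem := by simpa using hz
    h_ne := by simpa [w] using hzne }⟩
  rw [List.length_range] at ht
  obtain ⟨q, -, ho⟩ := hrec c 0
  have h1 := ho.getD_lt (t := t) (by rw [hwl]; exact ht)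
  rw [hwl] at h1
  have h2 : w (c % 2) = w c := by simp [w]
  rw [h2, List.getElem?_range h1]
  simp [List.getD, ht]

/-- Numbering of the integer `t - a`: the nonnegative integers get the even numbers. -/
def zigzag (t a : ℕ) : ℕ := if t < a then 2 * (a - 1 - t) + 1 else 2 * (t - a)

theorem zigzag_eq_iff {t a t' a' : ℕ} : zigzag t a = zigzag t' a' ↔ t + a' = t' + a := by
  unfold zigzag; split_ifs <;> omega

theorem computable_zigzag : Computable₂ zigzag := by
  have ht : Primrec fun p : ℕ × ℕ => p.1 := Primrec.fst
  have ha : Primrec fun p : ℕ × ℕ => p.2 := Primrec.snd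
  refine Primrec.to_comp (Primrec.ite (Primrec.nat_lt.comp ht ha) ?_ ?_)
  · exact Primrec.nat_double_succ.comp (Primrec.nat_sub.comp
      (Primrec.nat_sub.comp ha (Primrec.const 1)) ht)
  · exact Primrec.nat_double.comp (Primrec.nat_sub.comp ht ha)

/-- The map `t ↦ t + V[t mod P] - (t mod P)`, with `P` the length of `V`. -/
def periodicMap (V : List ℕ) (t : ℕ) : ℕ :=
  t / V.length * V.length + V.getD (t % V.length) 0

theorem periodicMap_add (V : List ℕ) (hV : 0 < V.length) (t e : ℕ) :
    periodicMap V (t + e * V.length) = periodicMap V t + e * V.length := by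
  unfold periodicMap
  rw [Nat.add_mul_div_right _ _ hV, Nat.add_mul_mod_self_right]
  ring

/-- Relative to a base that is a multiple of the period, the map does not depend on the base. The
equations are written with sums to avoid truncated subtraction. -/
theorem periodicMap_shift {V : List ℕ} (hV : 0 < V.length) {t t' c c' : ℕ}
    (h : t' + c * V.length = t + c' * V.length) :
    periodicMap V t' + c * V.length = periodicMap V t + c' * V.length := by
  rw [← periodicMap_add V hV, ← periodicMap_add V hV, h]

theorem computable_periodicMap (V : List ℕ) : Computable (periodicMap V) := by
  refine Primrec.to_comp (Primrec.nat_add.comp (Primrec.nat_mul.comp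
    (Primrec.nat_div.comp Primrec.id (Primrec.const _)) (Primrec.const _))
    ((Primrec.list_getD 0).comp (Primrec.const V)
      (Primrec.nat_mod.comp Primrec.id (Primrec.const _))))

/-- The elements are integers, laid out along a power of `V` with the integer `0` at position `a c`.
The induced map on integers is `n ↦ w (n + a c) - a c`, which depends only on `a c` modulo the
period, that is, on the parity of `c`. Passing from `c` to `c + 1` adds elements on both sides and
changes the phase. -/
theorem CodingGadget.nonempty_of_powWord {f : ℕ → ℕ} {V : List ℕ} (hV : 0 < V.length)
    (hne : ∃ t < V.length, V.getD t 0 ≠ t) (hrec : ∀ k, IsRec f (powWord V k)) :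
    Nonempty (CodingGadget f) := by
  set P := V.length with hP
  have hVlt : ∀ t < P, V.getD t 0 < P := by
    intro t ht
    obtain ⟨q, -, ho⟩ := hrec 1 0
    have := ho.getD_lt (t := t) (by simpa using ht)
    rw [powWord_getD (by simpa using ht), length_powWord, ← hP, Nat.div_eq_of_lt ht,
      Nat.mod_eq_of_lt ht] at this
    simpa using this
  let w := periodicMap V
  have hwlt : ∀ k t, t < k * P → w t < k * P := by
    intro k t ht
    have h1 : t / P < k := Nat.div_lt_of_lt_mul (by rwa [Nat.mul_comm])
    have h2 := hVlt (t % P) (Nat.mod_lt _ hV)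
    have h3 : (t / P + 1) * P ≤ k * P := Nat.mul_le_mul_right _ h1
    simp only [w, periodicMap, ← hP]
    rw [Nat.succ_mul] at h3
    omega
  let a : ℕ → ℕ := fun c => c * P + c % 2
  let E : ℕ → List ℕ := fun c => (List.range ((2 * c + 1) * P)).map fun t => zigzag t (a c)
  -- `idx x a` is the position of the integer coded by `x` when `0` sits at `a`.
  let idx : ℕ → ℕ → ℕ := fun x a => if x % 2 = 1 then a - 1 - x / 2 else a + x / 2
  -- For `b < 2` this is `a (2 * x + b)`: a base of phase `b`, large enough that the integer coded
  -- by `x` gets a position without truncation.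
  let ab : ℕ → ℕ → ℕ := fun b x => (2 * x + b) * P + b
  let h : ℕ → ℕ → ℕ := fun b x => zigzag (w (idx x (ab b x))) (ab b x)
  have ha : Computable a := Primrec.to_comp (Primrec.nat_add.comp
    (Primrec.nat_mul.comp Primrec.id (Primrec.const P))
    (Primrec.nat_mod.comp Primrec.id (Primrec.const 2)))
  have hab : Primrec fun p : ℕ × ℕ => ab p.1 p.2 := Primrec.nat_add.comp
    (Primrec.nat_mul.comp (Primrec.nat_add.comp (Primrec.nat_double.comp Primrec.snd)
      Primrec.fst) (Primrec.const P)) Primrec.fst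
  have hidx : Primrec fun p : ℕ × ℕ => idx p.1 p.2 := by
    have hx : Primrec fun p : ℕ × ℕ => p.1 / 2 :=
      Primrec.nat_div.comp Primrec.fst (Primrec.const 2)
    refine Primrec.ite (Primrec.eq.comp (Primrec.nat_mod.comp Primrec.fst (Primrec.const 2))
      (Primrec.const 1)) ?_ (Primrec.nat_add.comp Primrec.snd hx)
    exact Primrec.nat_sub.comp (Primrec.nat_sub.comp Primrec.snd (Primrec.const 1)) hx
  have hodd : Computable fun c : ℕ => 2 * c + 1 := Primrec.nat_double_succ.to_comp
  have hE : Computable E := computable_list_map (g := fun c t => zigzag t (a c))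
    (Primrec.list_range.to_comp.comp
      (Primrec.nat_mul.to_comp.comp hodd (Computable.const P)))
    (computable_zigzag.comp Computable.snd (ha.comp Computable.fst))
  have hW : Computable fun c => powWord V (2 * c + 1) :=
    computable_list_map (g := fun _ t => periodicMap V t)
      (Primrec.list_range.to_comp.comp
        (Primrec.nat_mul.to_comp.comp hodd (Computable.const P)))
      ((computable_periodicMap V).comp Computable.snd)
  have hh : Computable₂ h := computable_zigzag.comp ((computable_periodicMap V).comp
    (hidx.to_comp.comp (Computable.snd.pair hab.to_comp))) hab.to_comp
  have hlen : ∀ c, (E c).length = (2 * c + 1) * P := fun c => by simp [E]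
  have hget : ∀ c t, t < (2 * c + 1) * P → (E c)[t]? = some (zigzag t (a c)) := by
    intro c t ht
    simp [E, ht]
  have hval : ∀ c t, h (c % 2) (zigzag t (a c)) = zigzag (w t) (a c) := by
    intro c t
    set x := zigzag t (a c) with hx
    have hcP : 2 * x + c % 2 ≤ (2 * x + c % 2) * P := Nat.le_mul_of_pos_right _ hV
    have h1 : idx x (ab (c % 2) x) + a c = t + ab (c % 2) x := by
      simp only [idx, ab, hx, zigzag] at hcP ⊢
      split_ifs at hcP ⊢ <;> omega
    have h2 : idx x (ab (c % 2) x) + c * P = t + (2 * x + c % 2) * P := by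
      simp only [a, ab] at h1 ⊢; omega
    have h3 : w _ + c * P = w t + (2 * x + c % 2) * P := periodicMap_shift hV h2
    rw [zigzag_eq_iff]
    simp only [a, ab] at h3 ⊢
    omega
  -- If both phases agreed on the integers from `0` to `P - 1`, then `w` would be a translation on
  -- `[0, P]`. As `w` preserves `[0, P)`, it would be the identity there, against nontriviality of
  -- `V`.
  have hz : ∃ t < P, h 0 (2 * t) ≠ h 1 (2 * t) := by
    by_contra! hcon
    have hstep : ∀ t < P, w (t + 1) = w t + 1 := by
      intro t ht
      have h1 := hcon t ht
      have e0 : 2 * t = zigzag t (a 0) := by simp [zigzag, a]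
      have e1 : 2 * t = zigzag (t + (P + 1)) (a 1) := by
        rw [e0, zigzag_eq_iff]; simp only [a]; omega
      rw [show h 0 (2 * t) = zigzag (w t) (a 0) by rw [e0]; exact hval 0 t,
        show h 1 (2 * t) = zigzag (w (t + (P + 1))) (a 1) by rw [e1]; exact hval 1 _,
        zigzag_eq_iff] at h1
      have h2 : w (t + 1 + 1 * P) = w (t + 1) + 1 * P := periodicMap_add V hV _ _
      rw [show t + (P + 1) = t + 1 + 1 * P by omega, h2] at h1
      simp only [a] at h1
      omega
    have hall : ∀ t ≤ P, w t = w 0 + t := by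
      intro t
      induction t with
      | zero => simp
      | succ t ih => intro ht; rw [hstep t (by omega), ih (by omega)]; omega
    have hlast := hwlt 1 (P - 1) (by omega)
    rw [hall (P - 1) (by omega)] at hlast
    obtain ⟨t, ht, htne⟩ := hne
    have h1 := hall t ht.le
    simp only [w, periodicMap, ← hP, Nat.div_eq_of_lt ht, Nat.mod_eq_of_lt ht] at h1 hlast
    omega
  obtain ⟨z, hz, hzne⟩ := hz
  refine ⟨{
    E := E
    W := fun c => powWord V (2 * c + 1)
    h := h
    z := 2 * z
    computable_E := hE
    computable_W := hW
    computable_h := hh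
    length_eq := fun c => by rw [hlen, length_powWord]
    nodup := fun c => List.nodup_range.map fun t t' htt => by
      have := zigzag_eq_iff.1 htt
      omega
    sublist := fun c => ?_
    map_eq := fun c t ht => ?_
    isRec := fun c => hrec _
    z_mem := ?_
    h_ne := hzne }⟩
  -- The base moves by `d`, at most `P + 1`, while the list gains `2 * P` elements. The old list is
  -- the segment of the new one that starts at `d`.
  · obtain ⟨d, hd, r, hr⟩ : ∃ d, a (c + 1) = a c + d ∧
        ∃ r, (2 * (c + 1) + 1) * P = d + (2 * c + 1) * P + r := by
      have e1 : (c + 1) * P = c * P + P := Nat.succ_mul _ _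
      have e2 : (2 * (c + 1) + 1) * P = (2 * c + 1) * P + 2 * P := by ring
      refine ⟨a (c + 1) - a c, by simp only [a]; omega,
        (2 * (c + 1) + 1) * P - (a (c + 1) - a c) - (2 * c + 1) * P, ?_⟩
      simp only [a]
      omega
    simp only [E]
    rw [hr, List.range_add, List.range_add, List.map_append, List.map_append]
    have : (List.range ((2 * c + 1) * P)).map (fun t => zigzag t (a c))
        = (((List.range ((2 * c + 1) * P)).map (d + ·)).map fun t => zigzag t (a (c + 1))) := by
      rw [List.map_map]
      refine List.map_congr_left fun t _ => ?_
      simp only [Function.comp, zigzag_eq_iff, hd]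
      omega
    rw [this]
    exact (List.sublist_append_right _ _).trans (List.sublist_append_left _ _)
  · rw [hlen] at ht
    have hw : (powWord V (2 * c + 1)).getD t 0 = w t := powWord_getD ht
    rw [hw, hget c _ (hwlt _ _ ht), List.getD_eq_getElem?_getD, hget c t ht]
    simp [hval]
  · simp only [E, List.mem_map, List.mem_range]
    exact ⟨z, by omega, by simp [zigzag, a]⟩

/-! ### Kinds of items -/

/-- The kinds of items from which a copy is built: kind `0` is a coding gadget, kind `1` an
initial segment of `f`, and the kinds `j ≥ 2` are recurring words that fill the gaps. -/
structure KindSystem (f : ℕ → ℕ) where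
  E : ℕ → ℕ → List ℕ
  W : ℕ → ℕ → List ℕ
  h : ℕ → ℕ → ℕ → ℕ
  z : ℕ
  computable_E : Computable₂ E
  computable_W : Computable₂ W
  computable_h : Computable fun p : ℕ × ℕ × ℕ => h p.1 p.2.1 p.2.2
  length_eq : ∀ j c, (E j c).length = (W j c).length
  ne_nil : ∀ j c, E j c ≠ []
  nodup : ∀ j c, (E j c).Nodup
  sublist : ∀ j c, (E j c).Sublist (E j (c + 1))
  map_eq : ∀ j c, ∀ t < (E j c).length,
    (E j c)[(W j c).getD t 0]? = some (h j (c % 2) ((E j c).getD t 0))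
  isRec : ∀ j c, j ≠ 1 → IsRec f (W j c)
  occ_root : ∀ c, Occ f 0 (W 1 c)
  fill : ∀ q p c₀, (W 1 c₀).length ≤ q → IsCut f q → IsCut f p → q < p →
    ∃ j, 2 ≤ j ∧ ∀ c, Occ f q (W j c) ∧ q + (W j c).length ≤ p
  z_mem : z ∈ E 0 0
  h_ne : h 0 0 z ≠ h 0 1 z

/-- The initial segment is chosen to reach past the last occurrence of every nonrecurring word of
length at most `K`. Beyond it, the word up to the next cut recurs, so the finitely many short
recurring words fill any gap between cuts. -/
theorem exists_kindSystem {f : ℕ → ℕ} {K : ℕ}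
    (hK : ∀ a, ∃ q, a < q ∧ q ≤ a + K ∧ IsCut f q) (hid : ¬ IsAlmostIdentity f) :
    Nonempty (KindSystem f) := by
  classical
  obtain ⟨G⟩ : Nonempty (CodingGadget f) := by
    rcases isRec_dichotomy hK hid with ⟨U, U', h1, h2, h3, h4⟩ | ⟨V, h1, h2, h3⟩
    · exact CodingGadget.nonempty_of_two_words h1 h2 h3 h4
    · exact CodingGadget.nonempty_of_powWord h1 h2 h3
  have hGne : ∀ c, G.E c ≠ [] := by
    intro c
    induction c with
    | zero => exact List.ne_nil_of_mem G.z_mem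
    | succ c ih => exact fun h => ih (List.sublist_nil.1 (h ▸ G.sublist c))
  obtain ⟨N, hN⟩ := exists_forall_occ_isRec f K
  obtain ⟨N₀, hN₀, -, hcut⟩ := hK N
  have hfin : {U : List ℕ | U.length ≤ K ∧ U ≠ [] ∧ IsRec f U}.Finite := by
    refine (finite_bounded_lists K).subset ?_
    rintro U ⟨h1, -, h2⟩
    obtain ⟨q, -, ho⟩ := h2 0
    exact ho.mem_bounded h1
  let root := wordAt f 0 N₀
  let L : List (List ℕ) := root :: hfin.toFinset.toList
  -- Kind `1` is the initial segment. The default, a nonempty recurring word, makes the requirements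
  -- hold also for kinds beyond the end of the list; `u 0` is never used.
  let u : ℕ → List ℕ := fun j => L.getD (j - 1) (G.W 0)
  have hroot : Occ f 0 root := occ_wordAt (isCut_zero f) (by simpa using hcut)
  have hmemL : ∀ U, U ∈ hfin.toFinset.toList ↔ U.length ≤ K ∧ U ≠ [] ∧ IsRec f U := by
    intro U; simp
  have hu1 : u 1 = root := rfl
  have hu : ∀ j, 2 ≤ j → u j ∈ hfin.toFinset.toList ∨ u j = G.W 0 := by
    intro j hj
    obtain ⟨i, rfl⟩ := Nat.exists_eq_add_of_le' hj
    simp only [u, L]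
    rw [show i + 2 - 1 = i + 1 by omega, List.getD_cons_succ]
    rcases lt_or_ge i hfin.toFinset.toList.length with h | h
    · left; rw [List.getD_eq_getElem _ _ h]; exact List.getElem_mem h
    · right; exact List.getD_eq_default _ _ h
  have hW0 : G.W 0 ≠ [] := by
    have := G.length_eq 0
    have h0 := List.length_pos_of_ne_nil (hGne 0)
    exact List.ne_nil_of_length_pos (by omega)
  have hune : ∀ j, j ≠ 0 → u j ≠ [] := by
    intro j hj
    rcases (by omega : j = 1 ∨ 2 ≤ j) with rfl | h
    · rw [hu1]; exact List.ne_nil_of_length_pos (by simp [root]; omega)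
    · rcases hu j h with h | h
      · exact ((hmemL _).1 h).2.1
      · rw [h]; exact hW0
  have hurec : ∀ j, 2 ≤ j → IsRec f (u j) := by
    intro j h
    rcases hu j h with h | h
    · exact ((hmemL _).1 h).2.2
    · rw [h]; exact G.isRec 0
  have huocc : ∀ j, j ≠ 0 → ∃ q, Occ f q (u j) := by
    intro j hj
    rcases (by omega : j = 1 ∨ 2 ≤ j) with rfl | h
    · exact ⟨0, hroot⟩
    · obtain ⟨q, -, h⟩ := hurec j h 0
      exact ⟨q, h⟩
  have hfill : ∀ q p, N₀ ≤ q → IsCut f q → IsCut f p → q < p →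
      ∃ j, 2 ≤ j ∧ Occ f q (u j) ∧ q + (u j).length ≤ p := by
    intro q p hq hc hp hqp
    obtain ⟨q', h1, h2, h3, h4⟩ : ∃ q', q < q' ∧ q' ≤ q + K ∧ IsCut f q' ∧ q' ≤ p := by
      obtain ⟨q', h1, h2, h3⟩ := hK q
      rcases le_total q' p with h | h
      · exact ⟨q', h1, h2, h3, h⟩
      · exact ⟨p, hqp, h.trans h2, hp, le_rfl⟩
    have ho := occ_wordAt (l := q' - q) hc (by rwa [show q + (q' - q) = q' by omega])
    have hm : wordAt f q (q' - q) ∈ hfin.toFinset.toList := by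
      rw [hmemL]
      exact ⟨by simp; omega, List.ne_nil_of_length_pos (by simp; omega),
        hN _ (by simp; omega) q (by omega) ho⟩
    obtain ⟨i, hi, hiU⟩ := List.getElem_of_mem hm
    refine ⟨i + 2, by omega, ?_⟩
    have : u (i + 2) = wordAt f q (q' - q) := by
      simp only [u, L]
      rw [show i + 2 - 1 = i + 1 by omega, List.getD_cons_succ, List.getD_eq_getElem _ _ hi, hiU]
    rw [this]
    exact ⟨ho, by simp; omega⟩
  have hzero : ComputablePred fun j : ℕ => j = 0 :=
    ComputablePred.eq Computable.id (Computable.const 0)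
  have hcu : Computable u := ((Primrec.list_getD (G.W 0)).comp (Primrec.const L)
    (Primrec.nat_sub.comp Primrec.id (Primrec.const 1))).to_comp
  refine ⟨{
    E := fun j c => if j = 0 then G.E c else List.range (u j).length
    W := fun j c => if j = 0 then G.W c else u j
    h := fun j b i => if j = 0 then G.h b i else (u j).getD i 0
    z := G.z
    computable_E := computable_ite (ComputablePred.comp hzero Computable.fst)
      (G.computable_E.comp Computable.snd)
      (Primrec.list_range.to_comp.comp (Computable.list_length.comp (hcu.comp Computable.fst)))
    computable_W := computable_ite (ComputablePred.comp hzero Computable.fst)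
      (G.computable_W.comp Computable.snd) (hcu.comp Computable.fst)
    computable_h := computable_ite (ComputablePred.comp hzero Computable.fst)
      (G.computable_h.comp (Computable.fst.comp Computable.snd)
        (Computable.snd.comp Computable.snd))
      (computable_list_getD.comp (hcu.comp Computable.fst) (Computable.snd.comp Computable.snd))
    length_eq := fun j c => ?_
    ne_nil := fun j c => ?_
    nodup := fun j c => ?_
    sublist := fun j c => ?_
    map_eq := fun j c t ht => ?_
    isRec := fun j c hj => ?_
    occ_root := fun c => ?_
    fill := fun q p c₀ hq hc hp hqp => ?_
    z_mem := by simpa using G.z_mem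
    h_ne := by simpa using G.h_ne }⟩
  · split_ifs
    · exact G.length_eq c
    · simp
  · split_ifs with h
    · exact hGne c
    · simpa using hune j h
  · split_ifs
    · exact G.nodup c
    · exact List.nodup_range
  · split_ifs
    · exact G.sublist c
    · exact List.Sublist.refl _
  · by_cases h : j = 0
    · simp only [h, if_true] at ht ⊢
      exact G.map_eq c t ht
    · simp only [h, if_false] at ht ⊢
      rw [List.length_range] at ht
      obtain ⟨q, ho⟩ := huocc j h
      rw [List.getElem?_range (ho.getD_lt ht), List.getD_eq_getElem (List.range _) _ (by simpa),
        List.getElem_range]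
  · split_ifs with h
    · exact G.isRec c
    · exact hurec j (by omega)
  · simpa using hu1 ▸ hroot
  · simp only [one_ne_zero, if_false, hu1] at hq
    obtain ⟨j, hj, ho⟩ := hfill q p (by simpa [root] using hq) hc hp hqp
    exact ⟨j, hj, fun c => by simpa [show j ≠ 0 by omega] using ho⟩

section Placing

/-! ### Placing items -/

/-- An item: its region, its kind, and a number that distinguishes items. -/
abbrev Item : Type := ℕ × ℕ × ℕ

/-- The item at the beginning of every copy. -/
def rootItem : Item := (0, 1, 0)

variable {f : ℕ → ℕ}

namespace KindSystem

/-- The word of an item, where `g` gives the number of mind changes for each region. -/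
def word (S : KindSystem f) (g : ℕ → ℕ) (x : Item) : List ℕ := S.W x.2.1 (g x.1)

/-- The elements of an item. -/
def elems (S : KindSystem f) (g : ℕ → ℕ) (x : Item) : List (Item × ℕ) :=
  (S.E x.2.1 (g x.1)).map fun i => (x, i)

/-- The elements of a list of items. -/
def flat (S : KindSystem f) (g : ℕ → ℕ) (I : List Item) : List (Item × ℕ) :=
  I.flatMap (S.elems g)

/-- The map that the words induce on the elements. -/
def act (S : KindSystem f) (b : ℕ) (x : Item × ℕ) : Item × ℕ :=
  (x.1, S.h x.1.2.1 b x.2)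

/-- The words of the items occur in `f` one after another from position `q` on. -/
def Placed (S : KindSystem f) (g : ℕ → ℕ) : ℕ → List Item → Prop
  | _, [] => True
  | q, x :: I => Occ f q (S.word g x) ∧ S.Placed g (q + (S.elems g x).length) I

variable (S : KindSystem f) {g g' : ℕ → ℕ}

theorem length_elems (x : Item) : (S.elems g x).length = (S.word g x).length := by
  simp [elems, word, S.length_eq]

theorem length_elems_pos (x : Item) : 0 < (S.elems g x).length := by
  simpa [elems] using List.length_pos_of_ne_nil (S.ne_nil x.2.1 (g x.1))

@[simp] theorem flat_nil : S.flat g [] = [] := rfl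

@[simp] theorem flat_cons (x : Item) (I : List Item) :
    S.flat g (x :: I) = S.elems g x ++ S.flat g I := rfl

@[simp] theorem flat_append (I J : List Item) :
    S.flat g (I ++ J) = S.flat g I ++ S.flat g J := List.flatMap_append

theorem placed_append {q : ℕ} {I J : List Item} :
    S.Placed g q (I ++ J) ↔ S.Placed g q I ∧ S.Placed g (q + (S.flat g I).length) J := by
  induction I generalizing q with
  | nil => simp [Placed]
  | cons x I ih => simp [Placed, ih, and_assoc, Nat.add_assoc]

theorem flat_congr {I : List Item} (h : ∀ x ∈ I, g x.1 = g' x.1) :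
    S.flat g I = S.flat g' I := by
  refine List.flatMap_congr fun x hx => ?_
  simp [elems, h x hx]

theorem Placed.congr {q : ℕ} {I : List Item} (hI : S.Placed g q I)
    (h : ∀ x ∈ I, g x.1 = g' x.1) : S.Placed g' q I := by
  induction I generalizing q with
  | nil => trivial
  | cons x I ih =>
    have hx := h x (by simp)
    refine ⟨by simpa [word, hx] using hI.1, ?_⟩
    have := ih hI.2 fun y hy => h y (by simp [hy])
    simpa [elems, hx] using this

theorem Placed.isCut {q : ℕ} {I : List Item} (hI : S.Placed g q I) (hq : IsCut f q) :
    IsCut f (q + (S.flat g I).length) := by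
  induction I generalizing q with
  | nil => simpa using hq
  | cons x I ih =>
    have h1 := hI.1.2.1
    rw [← S.length_elems] at h1
    simpa [Nat.add_assoc] using ih hI.2 h1

/-- Replaces the recursion by bounded quantifiers, the form in which computability is proved. -/
theorem placed_iff {q : ℕ} {I : List Item} : S.Placed g q I ↔
    ∀ i < I.length, ∀ x ∈ I[i]?.toList,
      Occ f (q + (S.flat g (I.take i)).length) (S.word g x) := by
  induction I generalizing q with
  | nil => simp [Placed]
  | cons x I ih =>
    simp only [Placed, ih]
    constructor
    · rintro ⟨h1, h2⟩ i hi y hy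
      cases i with
      | zero => simp at hy; subst hy; simpa using h1
      | succ i =>
        have := h2 i (by simpa using hi) y (by simpa using hy)
        simpa [Nat.add_assoc] using this
    · intro h
      refine ⟨by simpa using h 0 (by simp) x (by simp), fun i hi y hy => ?_⟩
      have := h (i + 1) (by simpa using hi) y (by simpa using hy)
      simpa [Nat.add_assoc] using this

/-- A word lies between two cuts, so `f` keeps each element inside its own item, where it acts as
the map of that kind. This links the listing of elements with `f` itself. -/
theorem Placed.getElem?_flat {q : ℕ} {I : List Item} (hI : S.Placed g q I) {t : ℕ}
    {x : Item × ℕ} (hx : (S.flat g I)[t]? = some x) :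
    q ≤ f (q + t) ∧ (S.flat g I)[f (q + t) - q]? = some (S.act (g x.1.1 % 2) x) := by
  induction I generalizing q t with
  | nil => simp at hx
  | cons y I ih =>
    rw [flat_cons] at hx ⊢
    have hl : (S.elems g y).length = (S.word g y).length := S.length_elems y
    rcases lt_or_ge t (S.elems g y).length with ht | ht
    · have hft := hI.1.2.2 t (hl ▸ ht)
      have hlt := hI.1.getD_lt (hl ▸ ht)
      rw [List.getElem?_append_left ht] at hx
      refine ⟨by omega, ?_⟩
      rw [hft, Nat.add_sub_cancel_left, List.getElem?_append_left (by omega)]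
      have hE : t < (S.E y.2.1 (g y.1)).length := by simpa [elems] using ht
      have hm := S.map_eq y.2.1 (g y.1) t hE
      simp only [elems, List.getElem?_map, List.getElem?_eq_getElem hE, Option.map_some,
        Option.some.injEq] at hx
      subst hx
      simp only [elems, List.getElem?_map, word, hm, Option.map_some, act]
      rw [List.getD_eq_getElem _ _ hE]
    · obtain ⟨u, rfl⟩ := Nat.exists_eq_add_of_le ht
      rw [List.getElem?_append_right (by omega), Nat.add_sub_cancel_left] at hx
      obtain ⟨h1, h2⟩ := ih hI.2 hx
      rw [Nat.add_assoc] at h1 h2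
      refine ⟨by omega, ?_⟩
      rw [List.getElem?_append_right (by omega)]
      convert h2 using 2
      omega

/-- Gaps between cuts can be filled with fresh items of any region. -/
theorem exists_fill (g : ℕ → ℕ) (n : ℕ) {q p : ℕ} (hq : (S.W 1 0).length ≤ q) (hcq : IsCut f q)
    (hcp : IsCut f p) (hqp : q ≤ p) (A : Finset Item) :
    ∃ F : List Item, S.Placed g q F ∧ q + (S.flat g F).length = p ∧ F.Nodup ∧
      ∀ x ∈ F, x ∉ A ∧ x.1 = n ∧ x.2.1 ≠ 1 := by
  obtain ⟨d, hd⟩ : ∃ d, d = p - q := ⟨_, rfl⟩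
  induction d using Nat.strong_induction_on generalizing q A with
  | _ d ih =>
    rcases Nat.eq_or_lt_of_le hqp with rfl | hlt
    · exact ⟨[], trivial, by simp, by simp, by simp⟩
    · obtain ⟨j, hj, hfill⟩ := S.fill q p 0 hq hcq hcp hlt
      obtain ⟨ho, hle⟩ := hfill (g n)
      -- The third component serves only to supply unused names for items.
      obtain ⟨k, hk⟩ : ∃ k, ((n, j, k) : Item) ∉ A := by
        by_contra! hcon
        have : (Set.range fun k : ℕ => ((n, j, k) : Item)).Finite :=
          A.finite_toSet.subset (by rintro _ ⟨k, rfl⟩; exact hcon k)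
        exact Set.infinite_range_of_injective (fun a b h => by simpa using h) this
      have hl : (S.elems g (n, j, k)).length = (S.W j (g n)).length := S.length_elems _
      have hpos := S.length_elems_pos (g := g) (n, j, k)
      obtain ⟨F, h1, h2, h3, h4⟩ := ih (p - (q + (S.elems g (n, j, k)).length)) (by omega)
        (q := q + (S.elems g (n, j, k)).length) (by omega) (by rw [hl]; exact ho.2.1) (by omega)
        (insert (n, j, k) A) rfl
      refine ⟨(n, j, k) :: F, ⟨ho, h1⟩, by simp; omega, ?_, ?_⟩
      · refine List.nodup_cons.2 ⟨fun hmem => ?_, h3⟩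
        exact (h4 _ hmem).1 (Finset.mem_insert_self _ _)
      · intro x hx
        rcases List.mem_cons.1 hx with rfl | hx
        · exact ⟨hk, rfl, by simp; omega⟩
        · obtain ⟨ha, hb⟩ := h4 x hx
          exact ⟨fun h => ha (Finset.mem_insert_of_mem h), hb⟩

/-- A list of items can be placed from any cut on, after adding fresh items. -/
theorem exists_placed (g : ℕ → ℕ) {J : List Item} (hk : ∀ x ∈ J, x.2.1 ≠ 1) (hnd : J.Nodup)
    (hs : J.Pairwise fun x y => x.1 ≤ y.1) {q : ℕ} (hq : (S.W 1 0).length ≤ q)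
    (hcq : IsCut f q) (A : Finset Item) :
    ∃ J' : List Item, S.Placed g q J' ∧ J.Sublist J' ∧ J'.Nodup ∧
      (J'.Pairwise fun x y => x.1 ≤ y.1) ∧
      ∀ x ∈ J', (x ∈ J ∨ x ∉ A) ∧ x.2.1 ≠ 1 ∧ ∃ y ∈ J, x.1 = y.1 := by
  classical
  induction J generalizing q A with
  | nil => exact ⟨[], trivial, List.Sublist.refl _, by simp, by simp, by simp⟩
  | cons x J ih =>
    obtain ⟨p, hp, ho⟩ := S.isRec x.2.1 (g x.1) (hk x (by simp)) q
    -- The filling in front of `x` gets the region of `x`, which keeps the list sorted, and avoids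
    -- the items still to be placed.
    obtain ⟨F, hF1, hF2, hF3, hF4⟩ := S.exists_fill g x.1 hq hcq ho.1 hp
      (A ∪ insert x J.toFinset)
    rw [List.nodup_cons] at hnd
    rw [List.pairwise_cons] at hs
    obtain ⟨J', h1, h2, h3, h4, h5⟩ := ih (fun y hy => hk y (by simp [hy])) hnd.2 hs.2
      (q := p + (S.elems g x).length) (by omega)
      (by rw [S.length_elems]; exact ho.2.1) (A ∪ insert x F.toFinset)
    have hJ'x : ∀ y ∈ J', x.1 ≤ y.1 := by
      intro y hy
      obtain ⟨-, -, z, hz, hyz⟩ := h5 y hy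
      rw [hyz]; exact hs.1 z hz
    refine ⟨F ++ x :: J', ?_, ?_, ?_, ?_, ?_⟩
    · rw [placed_append]
      refine ⟨hF1, ?_⟩
      rw [hF2]
      exact ⟨ho, h1⟩
    · exact (h2.cons_cons x).trans (List.sublist_append_right _ _)
    · rw [List.nodup_append]
      refine ⟨hF3, List.nodup_cons.2 ⟨fun hx => ?_, h3⟩, ?_⟩
      · rcases (h5 x hx).1 with h | h
        · exact hnd.1 h
        · exact h (by simp)
      · rintro y hy z hz rfl
        have hyA := (hF4 y hy).1
        rcases List.mem_cons.1 hz with rfl | hz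
        · exact hyA (by simp)
        · rcases (h5 y hz).1 with h | h
          · exact hyA (by simp [h])
          · exact h (by simp [hy])
    · rw [List.pairwise_append, List.pairwise_cons]
      refine ⟨?_, ⟨hJ'x, h4⟩, ?_⟩
      · exact List.pairwise_of_forall_mem_list fun y hy z hz => by
          rw [(hF4 y hy).2.1, (hF4 z hz).2.1]
      · intro y hy z hz
        rw [(hF4 y hy).2.1]
        rcases List.mem_cons.1 hz with rfl | hz
        · exact le_rfl
        · exact hJ'x z hz
    · intro y hy
      rcases List.mem_append.1 hy with hy | hy
      · obtain ⟨ha, hb, hc⟩ := hF4 y hy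
        exact ⟨Or.inr fun h => ha (by simp [h]), hc, x, by simp, hb⟩
      · rcases List.mem_cons.1 hy with rfl | hy
        · exact ⟨Or.inl (by simp), hk _ (by simp), y, by simp, rfl⟩
        · obtain ⟨ha, hb, z, hz, hyz⟩ := h5 y hy
          refine ⟨?_, hb, z, by simp [hz], hyz⟩
          rcases ha with h | h
          · exact Or.inl (by simp [h])
          · exact Or.inr fun h' => h (by simp [h'])

end KindSystem

/-! ### The stages of the construction -/

theorem filter_append_filter_of_pairwise {J : List Item}
    (hs : J.Pairwise fun x y => x.1 ≤ y.1) (n : ℕ) :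
    J.filter (·.1 ≤ n) ++ J.filter (fun x => n < x.1) = J := by
  induction J with
  | nil => rfl
  | cons x J ih =>
    rw [List.pairwise_cons] at hs
    by_cases h : x.1 ≤ n
    · simp [h, ih hs.2]
    · have h1 : J.filter (·.1 ≤ n) = [] :=
        List.filter_eq_nil_iff.2 fun y hy => by have := hs.1 y hy; simp; omega
      have h2 := ih hs.2
      rw [h1, List.nil_append] at h2
      simp [h, h1, h2, not_le.1 h]

/-- `I'` is a possible list of items at stage `s + 1` if `I` is the list at stage `s`. -/
def Step (S : KindSystem f) (c : ℕ → ℕ → ℕ) (s : ℕ) (I I' : List Item) : Prop :=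
  (I = I'.filter (· ∈ I) ∧ I'.Nodup ∧ I'.Pairwise fun x y => x.1 ≤ y.1) ∧
  ((∀ x ∈ I', x.1 ≤ s + 1) ∧ (∀ x ∈ I', x.2.1 = 1 → x = rootItem) ∧ (s + 1, 0, 0) ∈ I') ∧
  S.Placed (c (s + 1)) 0 I' ∧
  ∀ n < s + 1, (∀ m < n + 1, c (s + 1) m = c s m) →
    I'.filter (·.1 ≤ n) = I.filter (·.1 ≤ n)

/-- The properties of the list of items at stage `s`. -/
structure StageInv (S : KindSystem f) (c : ℕ → ℕ → ℕ) (s : ℕ) (I : List Item) : Prop where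
  nodup : I.Nodup
  sorted : I.Pairwise fun x y => x.1 ≤ y.1
  le : ∀ x ∈ I, x.1 ≤ s
  root : ∀ x ∈ I, x.2.1 = 1 → x = rootItem
  placed : S.Placed (c s) 0 I
  filter_zero : I.filter (·.1 ≤ 0) = [rootItem]
  mem : ∀ n, 1 ≤ n → n ≤ s → ((n, 0, 0) : Item) ∈ I

/-- Turns being a sublist into an equation of lists, the evidently decidable form used in `Step`. -/
theorem eq_filter_of_sublist {α : Type*} [BEq α] [LawfulBEq α] {I I' : List α} (h : I.Sublist I')
    (hnd : I'.Nodup) : I = I'.filter (· ∈ I) := by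
  have h1 : I.Sublist (I'.filter (· ∈ I)) := by
    have := h.filter (· ∈ I)
    rwa [List.filter_eq_self.2 (by simp)] at this
  refine h1.eq_of_length_le ?_
  refine ((hnd.filter _).subperm ?_).length_le
  intro x hx
  simpa using (List.mem_filter.1 hx).2

variable {S : KindSystem f} {c : ℕ → ℕ → ℕ}

theorem stageInv_zero : StageInv S c 0 [rootItem] where
  nodup := by simp
  sorted := by simp
  le := by simp [rootItem]
  root := by simp
  placed := ⟨by simpa [KindSystem.word, rootItem] using S.occ_root _, trivial⟩
  filter_zero := by simp [rootItem]
  mem := by omega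

theorem StageInv.step (hc0 : ∀ s, c s 0 = 0) {s : ℕ} {I I' : List Item} (h : StageInv S c s I)
    (h' : Step S c s I I') : StageInv S c (s + 1) I' where
  nodup := h'.1.2.1
  sorted := h'.1.2.2
  le := h'.2.1.1
  root := h'.2.1.2.1
  placed := h'.2.2.1
  filter_zero := by
    rw [h'.2.2.2 0 (by omega) (fun m hm => by
      rw [show m = 0 by omega, hc0, hc0]), h.filter_zero]
  mem n h1 h2 := by
    rcases Nat.lt_or_eq_of_le h2 with h2 | rfl
    · have := h.mem n h1 (by omega)
      rw [h'.1.1] at this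
      exact (List.mem_filter.1 this).1
    · exact h'.2.1.2.2

/-- The items of the regions below the first mind change stay where they are. All later items are
placed afresh behind them, followed by the new gadget, which is possible because their words recur.
The item of the initial segment, whose word need not recur, lies in region `0`, which never changes.
-/
theorem StageInv.exists_step (hc0 : ∀ s, c s 0 = 0) {s : ℕ} {I : List Item}
    (h : StageInv S c s I) : ∃ I', Step S c s I I' := by
  classical
  let Q : ℕ → Prop := fun n => ∀ m < n + 1, c (s + 1) m = c s m
  have hQ0 : Q 0 := fun m hm => by rw [show m = 0 by omega, hc0, hc0]
  -- `n₀` is the last region up to `s` before any change of the counters; region `0` shows that it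
  -- exists.
  obtain ⟨n₀, hn₀s, hn₀, hmax⟩ : ∃ n₀ ≤ s, Q n₀ ∧ ∀ n < s + 1, Q n → n ≤ n₀ :=
    ⟨Nat.findGreatest Q s, Nat.findGreatest_le s, Nat.findGreatest_spec (Nat.zero_le s) hQ0,
      fun n hn hq => Nat.le_findGreatest (by omega) hq⟩
  set A := I.filter (·.1 ≤ n₀) with hA
  set J := I.filter (fun x => n₀ < x.1) with hJ
  have hI : A ++ J = I := filter_append_filter_of_pairwise h.sorted n₀
  have hAagree : ∀ x ∈ A, c s x.1 = c (s + 1) x.1 := fun x hx =>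
    (hn₀ x.1 (by have := (List.mem_filter.1 hx).2; simp at this; omega)).symm
  have hplaced := h.placed
  rw [← hI, S.placed_append] at hplaced
  have hPA : S.Placed (c (s + 1)) 0 A := hplaced.1.congr S hAagree
  have hrootA : rootItem ∈ A := by
    have : rootItem ∈ I.filter (·.1 ≤ 0) := by rw [h.filter_zero]; simp
    exact List.mem_filter.2 ⟨(List.mem_filter.1 this).1, by simp [rootItem]⟩
  -- The kept part contains the initial segment of `f`, so everything placed after it is in the
  -- range where gaps can be filled.
  have hlenA : (S.W 1 0).length ≤ 0 + (S.flat (c (s + 1)) A).length := by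
    obtain ⟨A₁, A₂, hA12⟩ := List.append_of_mem hrootA
    have := S.length_elems (g := c (s + 1)) rootItem
    simp only [KindSystem.word, rootItem, hc0] at this
    rw [hA12]
    simp only [KindSystem.flat_append, KindSystem.flat_cons, List.length_append, rootItem, this]
    omega
  have hnew : ((s + 1, 0, 0) : Item) ∉ I := fun hmem => by
    have := h.le _ hmem
    simp at this
  have hJI : ∀ x ∈ J, x ∈ I ∧ n₀ < x.1 := fun x hx => by
    simpa using List.mem_filter.1 hx
  obtain ⟨J', h1, h2, h3, h4, h5⟩ := S.exists_placed (c (s + 1)) (J := J ++ [(s + 1, 0, 0)])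
    (by
      intro x hx hx1
      rcases List.mem_append.1 hx with hx | hx
      · have := h.root x (hJI x hx).1 hx1
        have h0 := (hJI x hx).2
        rw [this] at h0
        simp [rootItem] at h0
      · simp only [List.mem_singleton] at hx
        subst hx
        simp at hx1)
    (by
      rw [List.nodup_append]
      refine ⟨h.nodup.filter _, by simp, ?_⟩
      rintro x hx y hy rfl
      simp only [List.mem_singleton] at hy
      subst hy
      exact hnew (hJI _ hx).1)
    (by
      rw [List.pairwise_append]
      refine ⟨h.sorted.filter _, by simp, ?_⟩
      intro x hx y hy
      simp only [List.mem_singleton] at hy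
      subst hy
      exact (h.le x (hJI x hx).1).trans (Nat.le_succ s))
    hlenA (hPA.isCut S (isCut_zero f)) A.toFinset
  have hreg : ∀ x ∈ J', n₀ < x.1 ∧ x.1 ≤ s + 1 := by
    intro x hx
    obtain ⟨-, -, y, hy, hxy⟩ := h5 x hx
    rw [hxy]
    rcases List.mem_append.1 hy with hy | hy
    · exact ⟨(hJI y hy).2, (h.le y (hJI y hy).1).trans (Nat.le_succ s)⟩
    · simp only [List.mem_singleton] at hy
      subst hy
      exact ⟨Nat.lt_succ_of_le hn₀s, le_rfl⟩
  have hAreg : ∀ x ∈ A, x ∈ I ∧ x.1 ≤ n₀ := fun x hx => by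
    simpa using List.mem_filter.1 hx
  have hnd : (A ++ J').Nodup := by
    rw [List.nodup_append]
    refine ⟨h.nodup.filter _, h3, ?_⟩
    rintro x hx y hy rfl
    have := (hAreg x hx).2
    have := (hreg x hy).1
    omega
  have hsub : I.Sublist (A ++ J') := by
    rw [← hI]
    exact (List.Sublist.refl A).append ((List.sublist_append_left _ _).trans h2)
  refine ⟨A ++ J', ⟨eq_filter_of_sublist hsub hnd, hnd, ?_⟩, ⟨?_, ?_, ?_⟩, ?_, ?_⟩
  · rw [List.pairwise_append]
    refine ⟨h.sorted.filter _, h4, fun x hx y hy => ?_⟩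
    have := (hAreg x hx).2
    have := (hreg y hy).1
    omega
  · intro x hx
    rcases List.mem_append.1 hx with hx | hx
    · exact (h.le x (hAreg x hx).1).trans (Nat.le_succ s)
    · exact (hreg x hx).2
  · intro x hx hx1
    rcases List.mem_append.1 hx with hx | hx
    · exact h.root x (hAreg x hx).1 hx1
    · exact absurd hx1 (h5 x hx).2.1
  · exact List.mem_append_right _ (h2.subset (by simp))
  · rw [S.placed_append]
    exact ⟨hPA, h1⟩
  · intro n hn hq
    have hnn := hmax n hn hq
    have e1 : J'.filter (·.1 ≤ n) = [] := List.filter_eq_nil_iff.2 fun x hx => by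
      have := (hreg x hx).1; simp; omega
    have e2 : J.filter (·.1 ≤ n) = [] := List.filter_eq_nil_iff.2 fun x hx => by
      have := (hJI x hx).2; simp; omega
    rw [← hI, List.filter_append, List.filter_append, e1, e2]

end Placing

section Stages

/-! ### The stages are computable -/

theorem ComputablePred.pairwise {α β : Type*} [Primcodable α] [Primcodable β] {l : α → List β}
    {p : β → β → Prop} (hl : Computable l) (hp : ComputablePred fun x : β × β => p x.1 x.2) :
    ComputablePred fun a => (l a).Pairwise p := by
  have : ComputablePred fun a => ∀ j < (l a).length, ∀ y ∈ (l a)[j]?.toList,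
      ∀ x ∈ (l a).take j, p x y := by
    refine ComputablePred.forall_lt (p := fun a j => ∀ y ∈ (l a)[j]?.toList,
      ∀ x ∈ (l a).take j, p x y) (Computable.list_length.comp hl) ?_
    refine ComputablePred.forall_mem (l := fun x : α × ℕ => (l x.1)[x.2]?.toList)
      (p := fun (x : α × ℕ) y => ∀ z ∈ (l x.1).take x.2, p z y)
      (Primrec.optionToList.to_comp.comp
        (Computable.list_getElem?.comp (hl.comp Computable.fst) Computable.snd)) ?_
    refine ComputablePred.forall_mem (l := fun x : (α × ℕ) × β => (l x.1.1).take x.1.2)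
      (p := fun (x : (α × ℕ) × β) z => p z x.2)
      (Primrec.list_take.to_comp.comp (Computable.snd.comp Computable.fst)
        (hl.comp (Computable.fst.comp Computable.fst))) ?_
    exact ComputablePred.comp hp (Computable.snd.pair (Computable.snd.comp Computable.fst))
  refine this.of_eq fun a => ?_
  rw [List.pairwise_iff_getElem]
  constructor
  · intro h i j hi hj hij
    refine h j hj _ (by simp [hj]) _ ?_
    rw [List.mem_take_iff_getElem]
    exact ⟨i, by omega, rfl⟩
  · intro h j hj y hy x hx
    rw [List.mem_take_iff_getElem] at hx
    obtain ⟨i, hi, rfl⟩ := hx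
    simp only [List.getElem?_eq_getElem hj, Option.toList_some, List.mem_singleton] at hy
    subst hy
    exact h i j (by omega) hj (by omega)

variable {f : ℕ → ℕ} {K : ℕ}

theorem computablePred_isCut (hf : Computable f)
    (hK : ∀ a, ∃ q, a < q ∧ q ≤ a + K ∧ IsCut f q) : ComputablePred (IsCut f) := by
  refine ComputablePred.of_eq ?_ fun q => (isCut_iff_bounded hK q).symm
  exact ComputablePred.forall_lt (p := fun q x => (f x < q ↔ x < q))
    (Primrec.nat_add.to_comp.comp Computable.id (Computable.const K))
    (ComputablePred.iff (ComputablePred.lt (hf.comp Computable.snd) Computable.fst)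
      (ComputablePred.lt Computable.snd Computable.fst))

theorem computablePred_occ (hf : Computable f)
    (hK : ∀ a, ∃ q, a < q ∧ q ≤ a + K ∧ IsCut f q) :
    ComputablePred fun p : ℕ × List ℕ => Occ f p.1 p.2 := by
  have hc := computablePred_isCut hf hK
  have hl : Computable fun p : ℕ × List ℕ => p.2.length :=
    Computable.list_length.comp Computable.snd
  have hadd : Computable₂ fun a b : ℕ => a + b := Primrec.nat_add.to_comp
  refine ComputablePred.and (ComputablePred.comp hc Computable.fst)
    (ComputablePred.and (ComputablePred.comp hc (hadd.comp Computable.fst hl)) ?_)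
  refine ComputablePred.forall_lt
    (p := fun (p : ℕ × List ℕ) t => f (p.1 + t) = p.1 + p.2.getD t 0) hl ?_
  have h1 : Computable fun x : (ℕ × List ℕ) × ℕ => x.1.1 := Computable.fst.comp Computable.fst
  exact ComputablePred.eq (hf.comp (hadd.comp h1 Computable.snd))
    (hadd.comp h1 (computable_list_getD.comp (Computable.snd.comp Computable.fst) Computable.snd))

variable (S : KindSystem f) {c : ℕ → ℕ → ℕ}

theorem computable_kind_region {g : ℕ → ℕ → List ℕ} (hg : Computable₂ g) (hc : Computable₂ c) :
    Computable fun p : ℕ × Item => g p.2.2.1 (c p.1 p.2.1) := by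
  have h1 : Computable fun p : ℕ × Item => p.2.2.1 :=
    Computable.fst.comp (Computable.snd.comp Computable.snd)
  have h2 : Computable fun p : ℕ × Item => p.2.1 := Computable.fst.comp Computable.snd
  have h3 : Computable fun p : ℕ × Item => c p.1 p.2.1 := hc.comp Computable.fst h2
  exact hg.comp h1 h3

theorem computable_word (hc : Computable₂ c) :
    Computable fun p : ℕ × Item => S.word (c p.1) p.2 :=
  computable_kind_region S.computable_W hc

theorem computable_flat (hc : Computable₂ c) :
    Computable fun p : ℕ × List Item => S.flat (c p.1) p.2 := by
  have hpair : Computable₂ fun (p : ℕ × Item) (i : ℕ) => (p.2, i) :=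
    (Computable.snd.comp Computable.fst).pair Computable.snd
  have helems : Computable fun p : ℕ × Item => S.elems (c p.1) p.2 :=
    computable_list_map (computable_kind_region S.computable_E hc) hpair
  have helems' : Computable₂ fun (p : ℕ × List Item) (x : Item) => S.elems (c p.1) x :=
    helems.comp (f := fun p : ℕ × Item => S.elems (c p.1) p.2)
      (g := fun y : (ℕ × List Item) × Item => (y.1.1, y.2))
      ((Computable.fst.comp Computable.fst).pair Computable.snd)
  exact computable_list_flatMap Computable.snd helems'

theorem computablePred_placed (hf : Computable f)
    (hK : ∀ a, ∃ q, a < q ∧ q ≤ a + K ∧ IsCut f q) (hc : Computable₂ c) :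
    ComputablePred fun p : ℕ × List Item => S.Placed (c p.1) 0 p.2 := by
  have hflat := computable_flat S hc
  have hword := computable_word S hc
  obtain ⟨g, hgdef⟩ : ∃ g : ℕ × List Item → ℕ → ℕ,
      g = fun p i => (S.flat (c p.1) (p.2.take i)).length := ⟨_, rfl⟩
  have hg : Computable fun y : (ℕ × List Item) × ℕ => g y.1 y.2 := by
    have h1 : Computable fun y : (ℕ × List Item) × ℕ => (y.1.1, y.1.2.take y.2) :=
      (Computable.fst.comp Computable.fst).pair
        (Primrec.list_take.to_comp.comp Computable.snd (Computable.snd.comp Computable.fst))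
    have h2 : Computable fun y : (ℕ × List Item) × ℕ => S.flat (c y.1.1) (y.1.2.take y.2) :=
      hflat.comp h1
    rw [hgdef]
    exact Computable.list_length.comp h2
  have hget : Computable fun y : (ℕ × List Item) × ℕ => y.1.2[y.2]?.toList :=
    Primrec.optionToList.to_comp.comp (Computable.list_getElem?.comp
      (Computable.snd.comp Computable.fst) Computable.snd)
  have hw : Computable fun y : ((ℕ × List Item) × ℕ) × Item => S.word (c y.1.1.1) y.2 := by
    have h1 : Computable fun y : ((ℕ × List Item) × ℕ) × Item => (y.1.1.1, y.2) :=
      (Computable.fst.comp (Computable.fst.comp Computable.fst)).pair Computable.snd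
    have h2 := hword.comp h1
    exact h2
  have hg' : Computable fun y : ((ℕ × List Item) × ℕ) × Item => g y.1.1 y.1.2 :=
    hg.comp Computable.fst
  have hpair := hg'.pair hw
  have hocc := ComputablePred.comp (computablePred_occ hf hK) hpair
  have hmem := ComputablePred.forall_mem
    (p := fun (y : (ℕ × List Item) × ℕ) x => Occ f (g y.1 y.2) (S.word (c y.1.1) x)) hget hocc
  have hall := ComputablePred.forall_lt (n := fun p : ℕ × List Item => p.2.length)
    (p := fun (p : ℕ × List Item) i => ∀ x ∈ p.2[i]?.toList, Occ f (g p i) (S.word (c p.1) x))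
    (Computable.list_length.comp Computable.snd) hmem
  refine hall.of_eq fun p => ?_
  simp only [S.placed_iff, Nat.zero_add, hgdef]

theorem computablePred_step (hf : Computable f)
    (hK : ∀ a, ∃ q, a < q ∧ q ≤ a + K ∧ IsCut f q) (hc : Computable₂ c) :
    ComputablePred fun p : ℕ × List Item × List Item => Step S c p.1 p.2.1 p.2.2 := by
  have hs : Computable fun p : ℕ × List Item × List Item => p.1 := Computable.fst
  have hI : Computable fun p : ℕ × List Item × List Item => p.2.1 :=
    Computable.fst.comp Computable.snd
  have hI' : Computable fun p : ℕ × List Item × List Item => p.2.2 :=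
    Computable.snd.comp Computable.snd
  have hs1 : Computable fun p : ℕ × List Item × List Item => p.1 + 1 := Computable.succ.comp hs
  refine ComputablePred.and (ComputablePred.and ?_ (ComputablePred.and ?_ ?_))
    (ComputablePred.and (ComputablePred.and ?_ (ComputablePred.and ?_ ?_))
      (ComputablePred.and ?_ ?_))
  · refine ComputablePred.eq hI ?_
    exact computable_list_filter (p := fun (p : ℕ × List Item × List Item) x => x ∈ p.2.1) hI'
      (ComputablePred.mem Computable.snd (hI.comp Computable.fst))
  · exact ComputablePred.pairwise (p := fun x y : Item => x ≠ y) hI'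
      (ComputablePred.eq Computable.fst Computable.snd).not
  · exact ComputablePred.pairwise (p := fun x y : Item => x.1 ≤ y.1) hI'
      (ComputablePred.le (Computable.fst.comp Computable.fst) (Computable.fst.comp Computable.snd))
  · exact ComputablePred.forall_mem
      (p := fun (p : ℕ × List Item × List Item) (x : Item) => x.1 ≤ p.1 + 1) hI'
      (ComputablePred.le (Computable.fst.comp Computable.snd) (hs1.comp Computable.fst))
  · exact ComputablePred.forall_mem
      (p := fun (p : ℕ × List Item × List Item) (x : Item) => x.2.1 = 1 → x = rootItem) hI'
      (ComputablePred.imp (ComputablePred.eq (Computable.fst.comp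
        (Computable.snd.comp Computable.snd)) (Computable.const 1))
        (ComputablePred.eq Computable.snd (Computable.const rootItem)))
  · exact ComputablePred.mem (hs1.pair (Computable.const ((0, 0) : ℕ × ℕ))) hI'
  · exact ComputablePred.comp (computablePred_placed S hf hK hc) (hs1.pair hI')
  · refine ComputablePred.forall_lt (p := fun (p : ℕ × List Item × List Item) n =>
      (∀ m < n + 1, c (p.1 + 1) m = c p.1 m) →
        p.2.2.filter (·.1 ≤ n) = p.2.1.filter (·.1 ≤ n)) hs1 ?_
    refine ComputablePred.imp ?_ (ComputablePred.eq ?_ ?_)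
    · exact ComputablePred.forall_lt
        (p := fun (p : (ℕ × List Item × List Item) × ℕ) m => c (p.1.1 + 1) m = c p.1.1 m)
        (Computable.succ.comp Computable.snd)
        (ComputablePred.eq (hc.comp (hs1.comp (Computable.fst.comp Computable.fst))
          Computable.snd) (hc.comp (hs.comp (Computable.fst.comp Computable.fst)) Computable.snd))
    · exact computable_list_filter
        (p := fun (p : (ℕ × List Item × List Item) × ℕ) (x : Item) => x.1 ≤ p.2)
        (hI'.comp Computable.fst)
        (ComputablePred.le (Computable.fst.comp Computable.snd)
          (Computable.snd.comp Computable.fst))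
    · exact computable_list_filter
        (p := fun (p : (ℕ × List Item × List Item) × ℕ) (x : Item) => x.1 ≤ p.2)
        (hI.comp Computable.fst)
        (ComputablePred.le (Computable.fst.comp Computable.snd)
          (Computable.snd.comp Computable.fst))

/-! ### The limit of the construction -/

theorem length_le_length_flat (g : ℕ → ℕ) (I : List Item) :
    I.length ≤ (S.flat g I).length := by
  induction I with
  | nil => simp
  | cons x I ih =>
    have := S.length_elems_pos (g := g) x
    simp; omega

theorem mem_flat {g : ℕ → ℕ} {I : List Item} {x : Item × ℕ} :
    x ∈ S.flat g I ↔ x.1 ∈ I ∧ x.2 ∈ S.E x.1.2.1 (g x.1.1) := by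
  simp only [KindSystem.flat, KindSystem.elems, List.mem_flatMap, List.mem_map]
  constructor
  · rintro ⟨y, hy, i, hi, rfl⟩
    exact ⟨hy, hi⟩
  · rintro ⟨h1, h2⟩
    exact ⟨x.1, h1, x.2, h2, rfl⟩

theorem nodup_flat {g : ℕ → ℕ} {I : List Item} (hI : I.Nodup) : (S.flat g I).Nodup := by
  rw [KindSystem.flat, List.nodup_flatMap]
  refine ⟨fun x _ => (S.nodup _ _).map fun i j h => by simpa using h, ?_⟩
  refine hI.imp fun {x y} hxy => ?_
  intro z hz hz'
  simp only [KindSystem.elems, List.mem_map] at hz hz'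
  obtain ⟨i, -, rfl⟩ := hz
  obtain ⟨j, -, h⟩ := hz'
  exact hxy (by simpa using (congrArg Prod.fst h).symm)

theorem sublist_E {j a b : ℕ} (h : a ≤ b) : (S.E j a).Sublist (S.E j b) := by
  induction b, h using Nat.le_induction with
  | base => exact List.Sublist.refl _
  | succ b _ ih => exact ih.trans (S.sublist j b)

theorem sublist_flat {g g' : ℕ → ℕ} (hg : ∀ n, g n ≤ g' n) {I I' : List Item}
    (h : I.Sublist I') : (S.flat g I).Sublist (S.flat g' I') := by
  induction h with
  | slnil => exact List.Sublist.refl _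
  | cons x _ ih => exact ih.trans (List.sublist_append_right _ _)
  | cons_cons x _ ih => exact ((sublist_E S (hg x.1)).map _).append ih

/-- The outcome of the construction: computable lists `L s` that converge to an enumeration
`lam` along which `f` is computed from the single bits of `X`. -/
theorem exists_listing (hf : Computable f) (hK : ∀ a, ∃ q, a < q ∧ q ≤ a + K ∧ IsCut f q)
    (hc : Computable₂ c) (hmono : ∀ s n, c s n ≤ c (s + 1) n) (hc0 : ∀ s, c s 0 = 0)
    {X : Set ℕ} (hlim : ∀ n, ∃ s₀, ∀ s ≥ s₀, c s n = c s₀ n ∧ (c s n % 2 = 1 ↔ n ∈ X)) :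
    ∃ (L : ℕ → List (Item × ℕ)) (lam : ℕ → Item × ℕ), Computable L ∧ (∀ s, (L s).Nodup) ∧
      (∀ s, (L s).Sublist (L (s + 1))) ∧ (∀ p, ∃ s₀, ∀ s ≥ s₀, (L s)[p]? = some (lam p)) ∧
      (∀ s, ∀ x ∈ L s, ∃ p, lam p = x) ∧
      (∀ p, lam (f p) = S.act (charFun X (lam p).1.1) (lam p)) ∧
      ∀ n, ∃ p, lam p = ((n + 1, 0, 0), S.z) := by
  obtain ⟨I, hI, -, hIs⟩ := exists_computable_seq (computablePred_step S hf hK hc)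
    (stageInv_zero (S := S) (c := c)) (fun s a h => h.exists_step hc0)
    (fun s a a' h h' => h.step hc0 h')
  let L : ℕ → List (Item × ℕ) := fun s => S.flat (c s) (I s)
  have hsubI : ∀ s, (I s).Sublist (I (s + 1)) := fun s => by
    rw [(hIs s).2.1.1]; exact List.filter_sublist
  have hsub : ∀ s, (L s).Sublist (L (s + 1)) := fun s => sublist_flat S (hmono s) (hsubI s)
  have hsubLe : ∀ s t, s ≤ t → (L s).Sublist (L t) := by
    intro s t h
    induction t, h using Nat.le_induction with
    | base => exact List.Sublist.refl _
    | succ t _ ih => exact ih.trans (hsub t)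
  have hnd : ∀ s, (L s).Nodup := fun s => nodup_flat S (hIs s).1.nodup
  -- the stage from which on the regions up to `N` are stable
  have hstab : ∀ N, ∃ s₀, N ≤ s₀ ∧ ∀ s ≥ s₀, ∀ m ≤ N, c s m = c s₀ m := by
    intro N
    choose t ht using hlim
    refine ⟨N + ((Finset.range (N + 1)).sup t), by omega, fun s hs m hm => ?_⟩
    have : t m ≤ (Finset.range (N + 1)).sup t := Finset.le_sup (by simp; omega)
    rw [(ht m s (by omega)).1, (ht m _ (by omega : t m ≤ N + (Finset.range (N + 1)).sup t)).1]
  -- Once the counters up to `N` are stable, the elements of the regions up to `N` form a fixed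
  -- initial segment. It has at least `N` elements, since it contains the gadgets of the regions
  -- from `1` to `N`. So every position converges, and every element reaches a final position.
  have hprefix : ∀ N, ∃ s₀ : ℕ, ∃ A : List (Item × ℕ), N ≤ A.length ∧
      (∀ s ≥ s₀, ∃ B, L s = A ++ B) ∧ ∀ s ≥ s₀, ∀ x ∈ L s, x.1.1 ≤ N → x ∈ A := by
    intro N
    obtain ⟨s₀, hNs, hs₀⟩ := hstab N
    have hconst : ∀ s ≥ s₀, (I s).filter (·.1 ≤ N) = (I s₀).filter (·.1 ≤ N) := by
      intro s hs
      induction s, hs using Nat.le_induction with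
      | base => rfl
      | succ s h ih =>
        rw [← ih]
        refine (hIs s).2.2.2.2 N (by omega) fun m hm => ?_
        rw [hs₀ (s + 1) (by omega) m (by omega), hs₀ s (by omega) m (by omega)]
    have hflat : ∀ s ≥ s₀, S.flat (c s) ((I s).filter (·.1 ≤ N))
        = S.flat (c s₀) ((I s₀).filter (·.1 ≤ N)) := by
      intro s hs
      rw [hconst s hs]
      refine S.flat_congr fun x hx => hs₀ s hs _ ?_
      simpa using (List.mem_filter.1 hx).2
    refine ⟨s₀, S.flat (c s₀) ((I s₀).filter (·.1 ≤ N)), ?_, fun s hs => ?_, ?_⟩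
    · refine le_trans ?_ (length_le_length_flat S _ _)
      have hsubset : (List.range N).map (fun n => ((n + 1, 0, 0) : Item))
          ⊆ (I s₀).filter (·.1 ≤ N) := by
        intro x hx
        simp only [List.mem_map, List.mem_range] at hx
        obtain ⟨n, hn, rfl⟩ := hx
        exact List.mem_filter.2 ⟨(hIs s₀).1.mem (n + 1) (by omega) (by omega),
          by simpa using hn⟩
      have hnd' : ((List.range N).map (fun n => ((n + 1, 0, 0) : Item))).Nodup :=
        List.nodup_range.map fun a b h => by simpa using h
      simpa using (hnd'.subperm hsubset).length_le
    · refine ⟨S.flat (c s) ((I s).filter fun x => N < x.1), ?_⟩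
      rw [← hflat s hs, ← S.flat_append,
        filter_append_filter_of_pairwise (hIs s).1.sorted]
    · intro s hs x hx hxN
      rw [← hflat s hs, mem_flat]
      obtain ⟨h1, h2⟩ := (mem_flat S).1 hx
      exact ⟨List.mem_filter.2 ⟨h1, by simpa using hxN⟩, h2⟩
  have hpos : ∀ p : ℕ, ∃ x, ∃ s₀ : ℕ, ∀ s ≥ s₀, (L s)[p]? = some x := by
    intro p
    obtain ⟨s₀, A, hA, hB, -⟩ := hprefix (p + 1)
    refine ⟨A[p]'(by omega), s₀, fun s hs => ?_⟩
    obtain ⟨B, hB⟩ := hB s hs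
    rw [hB, List.getElem?_append_left (by omega), List.getElem?_eq_getElem]
  choose lam hlam using hpos
  have hmem : ∀ s, ∀ x ∈ L s, ∃ p, lam p = x := by
    intro s x hx
    obtain ⟨s₀, A, -, hB, hA⟩ := hprefix x.1.1
    have hxA : x ∈ A := hA (s + s₀) (by omega) x ((hsubLe s _ (by omega)).subset hx) le_rfl
    obtain ⟨p, hp, hpx⟩ := List.getElem_of_mem hxA
    refine ⟨p, ?_⟩
    obtain ⟨s₁, hs₁⟩ := hlam p
    obtain ⟨B, hB⟩ := hB (s₁ + s₀) (by omega)
    have h1 := hs₁ (s₁ + s₀) (by omega)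
    rw [hB, List.getElem?_append_left hp, List.getElem?_eq_getElem hp, hpx] at h1
    exact (Option.some.inj h1).symm
  have hflat := computable_flat S hc
  refine ⟨L, lam, hflat.comp (Computable.id.pair hI), hnd, hsub, hlam, hmem,
    fun p => ?_, fun n => ?_⟩
  · obtain ⟨s₁, h₁⟩ := hlam p
    obtain ⟨s₂, h₂⟩ := hlam (f p)
    obtain ⟨s₃, h₃⟩ := hlim (lam p).1.1
    set s := s₁ + s₂ + s₃ with hs
    have hact := ((hIs s).1.placed.getElem?_flat S (t := p) (h₁ s (by omega))).2
    rw [Nat.zero_add, Nat.sub_zero] at hact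
    have hchar : c s (lam p).1.1 % 2 = charFun X (lam p).1.1 := by
      have := (h₃ s (by omega)).2
      unfold charFun
      split_ifs with h
      · exact this.2 h
      · have h' := mt this.1 h
        omega
    rw [hchar] at hact
    exact Option.some.inj ((h₂ s (by omega)).symm.trans hact)
  · refine hmem (n + 1) _ ((mem_flat S).2 ⟨(hIs (n + 1)).1.mem (n + 1) (by omega) le_rfl, ?_⟩)
    exact (sublist_E S (Nat.zero_le _)).subset S.z_mem

end Stages

/-! ### Turing reductions -/

/-- One query to `Y` per input, at a computable place, followed by a computable decision, suffices
for all the reductions below. -/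
theorem turingReducible_of_query {X Y : Set ℕ} {q : ℕ → ℕ} (hq : Computable q)
    {P : ℕ → ℕ → Prop} (hP : ComputablePred fun p : ℕ × ℕ => P p.1 p.2)
    (h : ∀ n, n ∈ X ↔ P n (charFun Y (q n))) :
    TuringReducible (charFun X : ℕ →. ℕ) (charFun Y : ℕ →. ℕ) := by
  classical
  let G : ℕ → ℕ := fun m => if P m.unpair.1 m.unpair.2 then 1 else 0
  have hG : Computable G := computable_ite
    (ComputablePred.comp hP Computable.unpair)
    (Computable.const 1) (Computable.const 0)
  have hGN : Nat.Partrec fun n => Part.some (G n) := Partrec.nat_iff.1 hG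
  have hqN : Nat.Partrec fun n => Part.some (q n) := Partrec.nat_iff.1 hq
  have hidN : Nat.Partrec fun n => Part.some n := Nat.Partrec.some
  have key := Nat.RecursiveIn.comp (O := {(charFun Y : ℕ →. ℕ)}) hGN.recursiveIn
    (Nat.RecursiveIn.pair hidN.recursiveIn
      (Nat.RecursiveIn.comp (Nat.RecursiveIn.oracle _ (Set.mem_singleton _)) hqN.recursiveIn))
  refine RecursiveIn.iff_nat.2 (key.of_eq fun n => ?_)
  have : G (Nat.pair n (charFun Y (q n))) = charFun X n := by
    simp only [G, Nat.unpair_pair, charFun, h n]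
  have hbind : (Part.some (q n) >>= (charFun Y : ℕ →. ℕ)) = Part.some (charFun Y (q n)) :=
    Part.bind_some _ _
  simp [Seq.seq, hbind, this]

theorem setDegree_eq {X Y : Set ℕ}
    (h : TuringReducible (charFun X : ℕ →. ℕ) (charFun Y : ℕ →. ℕ))
    (h' : TuringReducible (charFun Y : ℕ →. ℕ) (charFun X : ℕ →. ℕ)) :
    setDegree X = setDegree Y :=
  Quotient.sound ⟨h, h'⟩

theorem charFun_eq_one {X : Set ℕ} {n : ℕ} : charFun X n = 1 ↔ n ∈ X := by
  unfold charFun; split_ifs with h <;> simp [h]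

/-! ### Computable copies from computable sequences of lists -/

/-- Later stages insert elements without changing the order of earlier ones. Hence the order of two
elements can be read off at any stage at which both are present. -/
theorem idxOf_lt_idxOf_iff_of_sublist {α : Type*} [DecidableEq α] {l l' : List α}
    (h : l.Sublist l') (hnd : l'.Nodup) {a b : α} (ha : a ∈ l) (hb : b ∈ l) :
    l.idxOf a < l.idxOf b ↔ l'.idxOf a < l'.idxOf b := by
  induction h with
  | slnil => simp at ha
  | cons x hs ih =>
    rw [List.nodup_cons] at hnd
    have hxa : x ≠ a := fun e => hnd.1 (e ▸ hs.subset ha)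
    have hxb : x ≠ b := fun e => hnd.1 (e ▸ hs.subset hb)
    rw [List.idxOf_cons_ne _ hxa, List.idxOf_cons_ne _ hxb, ih hnd.2 ha hb]
    omega
  | cons_cons x hs ih =>
    rw [List.nodup_cons] at hnd
    by_cases hxb : x = b
    · subst hxb; simp
    · by_cases hxa : x = a
      · subst hxa
        simp [List.idxOf_cons_ne _ hxb]
      · rw [List.idxOf_cons_ne _ hxa, List.idxOf_cons_ne _ hxb, List.idxOf_cons_ne _ hxa,
          List.idxOf_cons_ne _ hxb]
        have := ih hnd.2 ((List.mem_cons.1 ha).resolve_left (Ne.symm hxa))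
          ((List.mem_cons.1 hb).resolve_left (Ne.symm hxb))
        omega

theorem getElem?_of_prefix {α : Type*} {M : ℕ → List α} (h : ∀ s, (M s) <+: (M (s + 1)))
    {s t k : ℕ} {x : α} (hst : s ≤ t) (hx : (M s)[k]? = some x) : (M t)[k]? = some x := by
  have hp : (M s) <+: (M t) := by
    induction t, hst using Nat.le_induction with
    | base => exact List.prefix_rfl
    | succ t _ ih => exact ih.trans (h t)
  obtain ⟨B, hB⟩ := hp
  obtain ⟨hk, -⟩ := List.getElem?_eq_some_iff.1 hx
  rw [← hB, List.getElem?_append_left hk, hx]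

section Copy

variable {α : Type*} [Primcodable α] [DecidableEq α]

/-- The union of a computable increasing sequence of finite lists has an injective computable
enumeration, if it is infinite. -/
theorem exists_injective_enum [Inhabited α] {L : ℕ → List α} (hL : Computable L)
    (hnd : ∀ s, (L s).Nodup) (hsub : ∀ s, (L s).Sublist (L (s + 1)))
    (hlen : ∀ p, ∃ s, p < (L s).length) :
    ∃ (e : ℕ → α) (st : ℕ → ℕ), Computable e ∧ Computable st ∧ Function.Injective e ∧
      (∀ k, e k ∈ L (st k)) ∧ ∀ s, ∀ x ∈ L s, ∃ k, e k = x := by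
  classical
  -- `M s` has the elements of `L s` in order of appearance: new elements go to the end, so the
  -- lists are prefixes of one another and the `k`-th entry is final once it exists.
  let M : ℕ → List α := fun s => Nat.rec (motive := fun _ => List α) (L 0)
    (fun s l => l ++ (L (s + 1)).filter (· ∉ l)) s
  have hMs : ∀ s, M (s + 1) = M s ++ (L (s + 1)).filter (· ∉ M s) := fun s => rfl
  have hM : Computable M := by
    have hfilter : Computable₂ fun (_ : ℕ) (q : ℕ × List α) =>
        q.2 ++ (L (q.1 + 1)).filter (· ∉ q.2) := by
      have h1 : Computable fun x : ℕ × ℕ × List α => x.2.2 := Computable.snd.comp Computable.snd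
      have h2 : Computable fun x : ℕ × ℕ × List α => L (x.2.1 + 1) :=
        hL.comp (Computable.succ.comp (Computable.fst.comp Computable.snd))
      have h3 := computable_list_filter (p := fun (x : ℕ × ℕ × List α) y => y ∉ x.2.2) h2
        (ComputablePred.mem (f := fun y : (ℕ × ℕ × List α) × α => y.2) Computable.snd
          (h1.comp Computable.fst)).not
      exact Computable.list_append.comp h1 h3
    exact Computable.nat_rec (f := fun s : ℕ => s) Computable.id (Computable.const (L 0)) hfilter
  have hpre : ∀ s, (M s) <+: (M (s + 1)) := fun s => ⟨_, (hMs s).symm⟩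
  have hmem : ∀ s x, x ∈ M s ↔ x ∈ L s := by
    intro s
    induction s with
    | zero => exact fun x => Iff.rfl
    | succ s ih =>
      intro x
      rw [hMs, List.mem_append, List.mem_filter]
      constructor
      · rintro (h | h)
        · exact (hsub s).subset ((ih x).1 h)
        · exact h.1
      · intro h
        by_cases hx : x ∈ M s
        · exact Or.inl hx
        · exact Or.inr ⟨h, by simpa using hx⟩
  have hMnd : ∀ s, (M s).Nodup := by
    intro s
    induction s with
    | zero => exact hnd 0
    | succ s ih =>
      rw [hMs, List.nodup_append]
      refine ⟨ih, (hnd _).filter _, ?_⟩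
      rintro x hx y hy rfl
      simpa [hx] using (List.mem_filter.1 hy).2
  have hMlen : ∀ p, ∃ s, p < (M s).length := by
    intro p
    obtain ⟨s, hs⟩ := hlen p
    refine ⟨s, hs.trans_le ?_⟩
    exact ((hnd s).subperm fun x hx => (hmem s x).2 hx).length_le
  let st : ℕ → ℕ := fun k => Nat.find (hMlen k)
  have hst : Computable st := computable_find (p := fun k s => k < (M s).length)
    (ComputablePred.lt Computable.fst (Computable.list_length.comp (hM.comp Computable.snd)))
    hMlen
  have hstlt : ∀ k, k < (M (st k)).length := fun k => Nat.find_spec (hMlen k)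
  let e : ℕ → α := fun k => (M (st k))[k]?.getD default
  have he : Computable e := Computable.option_getD
    (Computable.list_getElem?.comp (hM.comp hst) Computable.id) (Computable.const default)
  have hek : ∀ k, (M (st k))[k]? = some (e k) := fun k => by
    simp only [e, List.getElem?_eq_getElem (hstlt k), Option.getD_some]
  refine ⟨e, st, he, hst, fun k k' hkk => ?_, fun k => ?_, fun s x hx => ?_⟩
  · have h1 := getElem?_of_prefix hpre (le_max_left (st k) (st k')) (hek k)
    have h2 := getElem?_of_prefix hpre (le_max_right (st k) (st k')) (hek k')
    rw [← hkk, ← h1] at h2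
    obtain ⟨hk, -⟩ := List.getElem?_eq_some_iff.1 h1
    exact ((List.getElem?_inj hk (hMnd _)).1 h2.symm)
  · rw [← hmem]
    exact List.mem_of_getElem? (hek k)
  · obtain ⟨k, hk, hkx⟩ := List.getElem_of_mem ((hmem s x).2 hx)
    refine ⟨k, ?_⟩
    have h0 : (M s)[k]? = some x := by rw [List.getElem?_eq_getElem hk, hkx]
    have h1 := getElem?_of_prefix hpre (le_max_left s (st k)) h0
    have h2 := getElem?_of_prefix hpre (le_max_right s (st k)) (hek k)
    exact (Option.some.inj (h1.symm.trans h2)).symm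

theorem exists_copy_of_listing [Inhabited α] {L : ℕ → List α} {lam : ℕ → α} (hL : Computable L)
    (hnd : ∀ s, (L s).Nodup) (hsub : ∀ s, (L s).Sublist (L (s + 1)))
    (hlam : ∀ p, ∃ s₀, ∀ s ≥ s₀, (L s)[p]? = some (lam p))
    (hmem : ∀ s, ∀ x ∈ L s, ∃ p, lam p = x) :
    ∃ (e : ℕ → α) (r : ℕ → ℕ → Prop) (φ : ((· < ·) : ℕ → ℕ → Prop) ≃r r),
      Computable e ∧ Function.Injective e ∧ IsComputableCopy r ∧ ∀ p, e (φ p) = lam p := by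
  obtain ⟨e, st, he, hst, hinj, hest, hsurj⟩ := exists_injective_enum hL hnd hsub fun p => by
    obtain ⟨s, hs⟩ := hlam p
    exact ⟨s, (List.getElem?_eq_some_iff.1 (hs s le_rfl)).1⟩
  have hsubLe : ∀ s t, s ≤ t → (L s).Sublist (L t) := by
    intro s t h
    induction t, h using Nat.le_induction with
    | base => exact List.Sublist.refl _
    | succ t _ ih => exact ih.trans (hsub t)
  have hlaminj : Function.Injective lam := by
    intro p p' hpp
    obtain ⟨s, hs⟩ := hlam p
    obtain ⟨s', hs'⟩ := hlam p'
    have h1 := hs (s + s') (by omega)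
    have h2 := hs' (s + s') (by omega)
    rw [← hpp, ← h1] at h2
    obtain ⟨hk, -⟩ := List.getElem?_eq_some_iff.1 h1
    exact (List.getElem?_inj hk (hnd _)).1 h2.symm
  have hσ : ∀ p, ∃ k, e k = lam p := by
    intro p
    obtain ⟨s, hs⟩ := hlam p
    exact hsurj s _ (List.mem_of_getElem? (hs s le_rfl))
  choose σ hσ using hσ
  have hbij : Function.Bijective σ := by
    constructor
    · intro p p' h
      exact hlaminj (by rw [← hσ, ← hσ, h])
    · intro k
      obtain ⟨p, hp⟩ := hmem _ _ (hest k)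
      exact ⟨p, hinj (by rw [hσ, hp])⟩
  let E : ℕ ≃ ℕ := Equiv.ofBijective σ hbij
  -- By stage `st x + st y` both elements have appeared.
  let r : ℕ → ℕ → Prop := fun x y =>
    (L (st x + st y)).idxOf (e x) < (L (st x + st y)).idxOf (e y)
  have hr : ∀ p p', r (σ p) (σ p') ↔ p < p' := by
    intro p p'
    obtain ⟨s, hs⟩ := hlam p
    obtain ⟨s', hs'⟩ := hlam p'
    set t := st (σ p) + st (σ p') with ht
    have hm : e (σ p) ∈ L t := (hsubLe _ _ (by omega)).subset (hest (σ p))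
    have hm' : e (σ p') ∈ L t := (hsubLe _ _ (by omega)).subset (hest (σ p'))
    have key := idxOf_lt_idxOf_iff_of_sublist (hsubLe t (t + s + s') (by omega)) (hnd _) hm hm'
    have hidx : ∀ i, (L (t + s + s'))[i]? = some (lam i) →
        (L (t + s + s')).idxOf (lam i) = i := by
      intro i hi
      obtain ⟨hi', hx⟩ := List.getElem?_eq_some_iff.1 hi
      rw [← hx]
      exact (hnd _).idxOf_getElem i hi'
    rw [hσ, hσ] at key
    rw [hidx p (hs _ (by omega)), hidx p' (hs' _ (by omega))] at key
    simp only [r, ← ht, hσ, key]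
  let φ : ((· < ·) : ℕ → ℕ → Prop) ≃r r := ⟨E, fun {p p'} => hr p p'⟩
  refine ⟨e, r, φ, he, hinj, ⟨?_, ⟨φ⟩⟩, fun p => hσ p⟩
  have hLp : Computable fun p : ℕ × ℕ => L (st p.1 + st p.2) :=
    hL.comp (Primrec.nat_add.to_comp.comp (hst.comp Computable.fst) (hst.comp Computable.snd))
  have hidx : Computable₂ fun (a : α) (l : List α) => l.idxOf a := Primrec.list_idxOf.to_comp
  exact ComputablePred.lt (hidx.comp (he.comp Computable.fst) hLp)
    (hidx.comp (he.comp Computable.snd) hLp)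

end Copy

/-! ### The degree spectrum -/

theorem turingReducible_shift (X : Set ℕ) :
    TuringReducible (charFun {n | ∃ m ∈ X, n = m + 1} : ℕ →. ℕ) (charFun X : ℕ →. ℕ) := by
  refine turingReducible_of_query (q := fun n => n - 1) (P := fun n b => n ≠ 0 ∧ b = 1)
    (Primrec.nat_sub.to_comp.comp Computable.id (Computable.const 1))
    (ComputablePred.and (ComputablePred.eq Computable.fst (Computable.const 0)).not
      (ComputablePred.eq Computable.snd (Computable.const 1))) fun n => ?_
  rw [charFun_eq_one]
  constructor
  · rintro ⟨m, hm, rfl⟩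
    simpa using hm
  · rintro ⟨h1, h2⟩
    exact ⟨n - 1, h2, by omega⟩

/-- Possibly only one of the candidate images `y₀ n` and `y₁ n` is an element of the copy. One
therefore searches for an index `b` of either, asks whether `b` is the image, and reads the answer
according to which candidate was found. -/
theorem turingReducible_of_decoding {α : Type*} [Primcodable α] [DecidableEq α] {X Y : Set ℕ}
    {e y y₀ y₁ : ℕ → α} (he : Computable e) (hy : Computable y) (hy₀ : Computable y₀)
    (hy₁ : Computable y₁) (hne : ∀ n, y₀ n ≠ y₁ n) (hyex : ∀ n, ∃ a, e a = y n)
    (hbex : ∀ n, ∃ b, e b = y₀ n ∨ e b = y₁ n)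
    (h₁ : ∀ n ∈ X, ∀ a b, e a = y n → (Nat.pair a b ∈ Y ↔ e b = y₁ n))
    (h₀ : ∀ n ∉ X, ∀ a b, e a = y n → (Nat.pair a b ∈ Y ↔ e b = y₀ n)) :
    TuringReducible (charFun X : ℕ →. ℕ) (charFun Y : ℕ →. ℕ) := by
  have hA := computable_find (p := fun n a => e a = y n)
    (ComputablePred.eq (he.comp Computable.snd) (hy.comp Computable.fst)) hyex
  have hB := computable_find (p := fun n b => e b = y₀ n ∨ e b = y₁ n)
    (ComputablePred.or (ComputablePred.eq (he.comp Computable.snd) (hy₀.comp Computable.fst))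
      (ComputablePred.eq (he.comp Computable.snd) (hy₁.comp Computable.fst))) hbex
  have hA' : ∀ n, e (Nat.find (hyex n)) = y n := fun n => Nat.find_spec (hyex n)
  have hB' : ∀ n, e (Nat.find (hbex n)) = y₀ n ∨ e (Nat.find (hbex n)) = y₁ n :=
    fun n => Nat.find_spec (hbex n)
  obtain ⟨A, hA, hA'⟩ : ∃ A : ℕ → ℕ, Computable A ∧ ∀ n, e (A n) = y n := ⟨_, hA, hA'⟩
  obtain ⟨B, hB, hB'⟩ : ∃ B : ℕ → ℕ, Computable B ∧ ∀ n, e (B n) = y₀ n ∨ e (B n) = y₁ n :=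
    ⟨_, hB, hB'⟩
  refine turingReducible_of_query (q := fun n => Nat.pair (A n) (B n))
    (P := fun n v => (v = 1 ↔ e (B n) = y₁ n)) (Primrec₂.natPair.to_comp.comp hA hB)
    (ComputablePred.iff (ComputablePred.eq Computable.snd (Computable.const 1))
      (ComputablePred.eq (he.comp (hB.comp Computable.fst)) (hy₁.comp Computable.fst)))
    fun n => ?_
  rw [charFun_eq_one]
  by_cases hn : n ∈ X
  · simp [hn, h₁ n hn _ _ (hA' n)]
  · rw [h₀ n hn _ _ (hA' n)]
    simp only [hn, false_iff]
    rcases hB' n with h | h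
    · rw [h]; simp [hne n]
    · rw [h]; simp [(hne n).symm]

theorem delta2Degrees_subset_dgSp {f : ℕ → ℕ} {K : ℕ} (hf : Computable f)
    (hK : ∀ a, ∃ q, a < q ∧ q ≤ a + K ∧ IsCut f q) (S : KindSystem f) :
    delta2Degrees ⊆ DgSp f := by
  classical
  rintro d ⟨X₀, hX₀, rfl⟩
  obtain ⟨c₀, hc₀, hmono₀, hlim₀⟩ := hX₀.exists_counter
  set X : Set ℕ := {n | ∃ m ∈ X₀, n = m + 1} with hX
  -- The set is shifted by one, leaving region `0` without mind changes for the initial segment of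
  -- `f`.
  let c : ℕ → ℕ → ℕ := fun s n => if n = 0 then 0 else c₀ s (n - 1)
  have hc : Computable₂ c := by
    have h1 : Computable fun p : ℕ × ℕ => p.2 - 1 :=
      Primrec.nat_sub.to_comp.comp Computable.snd (Computable.const 1)
    exact computable_ite (ComputablePred.eq Computable.snd (Computable.const 0))
      (Computable.const 0) (hc₀.comp Computable.fst h1)
  have hmono : ∀ s n, c s n ≤ c (s + 1) n := fun s n => by
    simp only [c]; split_ifs <;> simp [hmono₀]
  have hlim : ∀ n, ∃ s₀, ∀ s ≥ s₀, c s n = c s₀ n ∧ (c s n % 2 = 1 ↔ n ∈ X) := by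
    intro n
    cases n with
    | zero => exact ⟨0, fun s _ => by simp [c, hX]⟩
    | succ n =>
      obtain ⟨s₀, hs₀⟩ := hlim₀ n
      exact ⟨s₀, fun s hs => by simpa [c, hX] using hs₀ s hs⟩
  obtain ⟨L, lam, hL, hnd, hsub, hlam, hmem, hact, hz⟩ :=
    exists_listing S hf hK hc hmono (fun s => by simp [c]) hlim
  obtain ⟨e, r, φ, he, hinj, hr, hφ⟩ := exists_copy_of_listing hL hnd hsub hlam hmem
  refine ⟨r, hr, φ, ?_⟩
  have hY : ∀ a b, Relation.Map (fun x y => f x = y) φ φ a b ↔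
      e b = S.act (charFun X (e a).1.1) (e a) := by
    intro a b
    have ha : e a = lam (φ.symm a) := by rw [← hφ]; simp
    have hb : e b = lam (φ.symm b) := by rw [← hφ]; simp
    rw [ha, ← hact]
    constructor
    · rintro ⟨x, y, rfl, rfl, rfl⟩
      rw [hφ]; simp
    · intro h
      rw [← hφ] at h
      exact ⟨φ.symm a, _, rfl, by simp, (hinj h).symm⟩
  have hactc : Computable fun p : ℕ × Item × ℕ => S.act p.1 p.2 := by
    have h1 : Computable fun p : ℕ × Item × ℕ => (p.2.1.2.1, p.1, p.2.2) :=
      (Computable.fst.comp (Computable.snd.comp (Computable.fst.comp Computable.snd))).pair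
        (Computable.fst.pair (Computable.snd.comp Computable.snd))
    have h2 := S.computable_h.comp h1
    exact (Computable.fst.comp Computable.snd).pair h2
  have hu1 : Computable fun n : ℕ => e n.unpair.1 :=
    he.comp (Computable.fst.comp Computable.unpair)
  have hu2 : Computable fun n : ℕ => e n.unpair.2 :=
    he.comp (Computable.snd.comp Computable.unpair)
  refine setDegree_eq (TuringReducible.trans ?_ (turingReducible_shift X₀)) ?_
  -- The only bit needed is that of the region to which the first element belongs.
  · refine turingReducible_of_query (q := fun n => (e n.unpair.1).1.1)
      (P := fun n b => e n.unpair.2 = S.act b (e n.unpair.1))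
      (Computable.fst.comp (Computable.fst.comp hu1)) ?_ fun n => hY _ _
    have h1 : Computable fun p : ℕ × ℕ => (p.2, e p.1.unpair.1) :=
      Computable.snd.pair (hu1.comp Computable.fst)
    have h2 := hactc.comp h1
    exact ComputablePred.eq (hu2.comp Computable.fst) h2
  · have hy : Computable fun n : ℕ => (((n + 1, 0, 0), S.z) : Item × ℕ) :=
      (Computable.succ.pair (Computable.const ((0, 0) : ℕ × ℕ))).pair (Computable.const S.z)
    have hact' : ∀ b, Computable fun n : ℕ => S.act b ((n + 1, 0, 0), S.z) := fun b => by
      have h1 := hactc.comp ((Computable.const b).pair hy)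
      exact h1
    have hyex : ∀ n, ∃ a, e a = ((n + 1, 0, 0), S.z) := fun n => by
      obtain ⟨p, hp⟩ := hz n
      exact ⟨φ p, by rw [hφ, hp]⟩
    have hchar : ∀ n, charFun X (n + 1) = charFun X₀ n := fun n => by simp [charFun, hX]
    have hY' : ∀ n a b, e a = ((n + 1, 0, 0), S.z) →
        (Nat.pair a b ∈ {m : ℕ | Relation.Map (fun x y => f x = y) φ φ m.unpair.1 m.unpair.2} ↔
          e b = S.act (charFun X₀ n) ((n + 1, 0, 0), S.z)) := by
      intro n a b ha
      rw [Set.mem_ofPred_eq, Nat.unpair_pair, hY, ha, hchar]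
    refine turingReducible_of_decoding he hy (hact' 0) (hact' 1) (fun n h => S.h_ne ?_) hyex
      (fun n => ?_) (fun n hn a b ha => ?_) fun n hn a b ha => ?_
    · exact congrArg Prod.snd h
    · obtain ⟨a, ha⟩ := hyex n
      -- The true image of the distinguished element is in the copy, and it is one of the two
      -- candidates.
      refine ⟨φ (f (φ.symm a)), ?_⟩
      rw [(hY a _).1 ⟨φ.symm a, _, rfl, by simp, rfl⟩, ha]
      unfold charFun
      split_ifs
      · exact Or.inr rfl
      · exact Or.inl rfl
    · rw [hY' n a b ha, charFun_eq_one.2 hn]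
    · rw [hY' n a b ha, show charFun X₀ n = 0 by simp [charFun, hn]]

end DegreeSpectra

theorem mainTheorem2 (f : ℕ → ℕ) (hf : Computable f)
    (hblock : DegreeSpectra.IsBlockFunction f)
    (htypes : Finite (DegreeSpectra.FType f))
    (hid : ¬ DegreeSpectra.IsAlmostIdentity f) :
    DegreeSpectra.DgSp f = DegreeSpectra.delta2Degrees := by
  obtain ⟨K, hK⟩ := DegreeSpectra.exists_cut_bound hblock htypes
  obtain ⟨S⟩ := DegreeSpectra.exists_kindSystem hK hid
  exact Set.Subset.antisymm (DegreeSpectra.dgSp_subset_delta2Degrees hf)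
    (DegreeSpectra.delta2Degrees_subset_dgSp hf hK S)
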